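/- **Theorem 1.** Let $\Gamma$ be a complete complex curve whose irreducible components $\Gamma_1,\dots,\Gamma_m$ are smooth and meet only at double points. Its normalization is the disjoint union $\Gamma_{\rm nm}=\Gamma_1\sqcup\dots\sqcup\Gamma_m$ of compact Riemann surfaces, and $\Gamma$ is obtained from it by gluing finitely many pairs of points $a\in\Gamma_p$, $b\in\Gamma_q$ ($p\ne q$), all these points being distinct. Let $P=P_1+\dots+P_n$, $Q=Q_1+\dots+Q_n$, $R=R_1+\dots+R_l$, $\gamma=\gamma_1+\dots+\gamma_r$ be divisors consisting of pairwise distinct nonsingular points of $\Gamma$, and let $k_j^{-1}$ be a local holomorphic parameter near $P_j$, with $k_j^{-1}(P_j)=0$. Let $\sigma:\Gamma\to\Gamma$ be a holomorphic involution (it permutes the components, $\sigma(\Gamma_s)=\Gamma_{\sigma(s)}$) with $\sigma(P_j)=P_j$, $\sigma(Q_j)=Q_j$ and $\sigma(k_j)=-k_j$ for all $j$. Let $\psi(u,\cdot)$, $u=(u^1,\dots,u^n)\in U$ with $U\subset\mathbb R^n$ or $U\subset\mathbb C^n$ open, be a Baker–Akhiezer section: a function on $\Gamma_{\rm nm}$,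 with restrictions $\psi_s$ to the components $\Gamma_s$, such that 1. near $P_j$ one has $\psi=e^{k_ju^j}\bigl(h_j(u)+\xi_j(u)k_j^{-1}+\dots\bigr)$, with a convergent power series in $k_j^{-1}$ as second factor; 2. $\psi$ is holomorphic on $\Gamma_{\rm nm}\setminus\{P_1,\dots,P_n\}$ except for at most simple poles at $\gamma_1,\dots,\gamma_r$; 3. $\psi(u,R_t)=d_t$, $t=1,\dots,l$, with constants $d_t$ that do not depend on $u$; 4. for every pair of glued points $a\in\Gamma_p$, $b\in\Gamma_q$, $$\psi_p(a)=\lambda\,\psi_q(b),\qquad \psi_{\sigma(p)}(\sigma(a))=\lambda_\sigma\,\psi_{\sigma(q)}(\sigma(b)),$$ where $\lambda=\lambda_{ab}$ and $\lambda_\sigma$ are non-zero constants (independent of $u$, and depending on the pair); 5. $\psi$ is continuously differentiable in $u$: away from the points $P_j$, $\gamma_s$ the derivative of $\psi$ in $u$ exists and is continuous in $u$ and the point of the curve jointly. Assume also that there is a meromorphic $1$-form $\Omega$ on $\Gamma$, given by meromorphic $1$-forms $\Omega_s\not\equiv0$ on the components $\Gamma_s$, such that - the divisor of zeros of $\Omega$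 (on $\Gamma_{\rm nm}$) is $(\Omega)_0=P+\gamma+\sigma\gamma$; - the divisor of poles of $\Omega$ is $Q+R+\sigma R$ plus, possibly, simple poles at some of the glued points; - for every pair of glued points $a\in\Gamma_p$, $b\in\Gamma_q$, $$\lambda\lambda_\sigma\,{\rm Res}_a\Omega_p+{\rm Res}_b\Omega_q=0,\qquad \lambda\lambda_\sigma\,{\rm Res}_{\sigma(a)}\Omega_{\sigma(p)}+{\rm Res}_{\sigma(b)}\Omega_{\sigma(q)}=0;$$ - ${\rm Res}_{Q_1}\Omega=\dots={\rm Res}_{Q_n}\Omega=1$. Then the functions $x^k(u)=\psi(u,Q_k)$ satisfy, for all $u\in U$, $$\partial_{u^i}x^1\,\partial_{u^j}x^1+\dots+\partial_{u^i}x^n\,\partial_{u^j}x^n=0,\qquad i\neq j.$$ -/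

import Mathlib

open scoped Manifold ContDiff Topology
open Set Filter

noncomputable section

namespace SpectralCurve

section Riemann

variable {X : Type*} [TopologicalSpace X] [ChartedSpace ℂ X]

/-- The point divisor `D 0 + D 1 + ... `, counted with multiplicity. -/
def divisor {k : ℕ} (D : Fin k → X) : X →₀ ℤ :=
  ∑ i, Finsupp.single (D i) 1

/-! ### Meromorphic functions and 1-forms on a one-dimensional complex manifold -/

/-- `f`, read in the preferred chart around `x`, is meromorphic at `x`. -/
def IsMeromorphicAt (f : X → ℂ) (x : X) : Prop :=
  MeromorphicAt (f ∘ (chartAt ℂ x).symm) (chartAt ℂ x x)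

/-- Order of the function `f` at `x` (negative at poles). -/
def order (f : X → ℂ) (x : X) : WithTop ℤ :=
  meromorphicOrderAt (f ∘ (chartAt ℂ x).symm) (chartAt ℂ x x)

variable (X) in
/-- A (not necessarily continuous) field of `ℂ`-linear forms on the holomorphic tangent spaces. Its
values at isolated points such as poles carry no information. -/
abbrev OneForm : Type _ := ∀ x : X, TangentSpace 𝓘(ℂ) x →L[ℂ] ℂ

/-- The function `g` such that `Ω = g(z) dz` in the preferred chart `z` around `x`. -/
def OneForm.coeff (Ω : OneForm X) (x : X) (z : ℂ) : ℂ :=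
  Ω ((chartAt ℂ x).symm z) (mfderiv 𝓘(ℂ) 𝓘(ℂ) (chartAt ℂ x).symm z (1 : ℂ))

/-- `Ω` is a meromorphic 1-form: locally `g(z) dz` with `g` meromorphic. -/
def OneForm.IsMeromorphic (Ω : OneForm X) : Prop :=
  ∀ x : X, MeromorphicAt (Ω.coeff x) (chartAt ℂ x x)

/-- Order of the 1-form `Ω` at `x`; it is `⊤` when `Ω` vanishes identically near `x`. -/
def OneForm.order (Ω : OneForm X) (x : X) : WithTop ℤ :=
  meromorphicOrderAt (Ω.coeff x) (chartAt ℂ x x)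

/-- Multiplicity of `x` in the divisor of zeros of `Ω`. -/
def OneForm.zeroMult (Ω : OneForm X) (x : X) : ℤ := max (Ω.order x).untop₀ 0

/-- Multiplicity of `x` in the divisor of poles of `Ω`. -/
def OneForm.poleMult (Ω : OneForm X) (x : X) : ℤ := max (-(Ω.order x).untop₀) 0

/-- Residue at `c` of a function on the plane having an isolated singularity at `c`: the common
value of `(2πi)⁻¹ ∮ g dz` over all small circles around `c`. -/
def planeResidue (g : ℂ → ℂ) (c : ℂ) : ℂ :=
  limUnder (𝓝[>] (0 : ℝ)) fun r : ℝ =>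
    (2 * (Real.pi : ℂ) * Complex.I)⁻¹ * ∮ z in C(c, r), g z

/-- Residue of the 1-form `Ω` at `x`. -/
def OneForm.residue (Ω : OneForm X) (x : X) : ℂ :=
  planeResidue (Ω.coeff x) (chartAt ℂ x x)

/-- `w` is a local holomorphic parameter at `p`. -/
structure IsLocalParameter (w : X → ℂ) (p : X) : Prop where
  holomorphic : ∀ᶠ x in 𝓝 p, MDifferentiableAt 𝓘(ℂ) 𝓘(ℂ) w x
  map_eq_zero : w p = 0
  mfderiv_ne_zero : mfderiv 𝓘(ℂ) 𝓘(ℂ) w p ≠ 0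

/-! ### Curves whose components are smooth and meet at double points -/

/-- A curve `Γ` whose irreducible components are smooth and meet at double points. It is given by
its normalization `X`, the disjoint union of the components (which therefore are the connected
components of `X`), and by the double points: the `e`-th one is obtained by gluing the
point `a e` of one component to the point `b e` of another component. -/
structure NodalCurve (X : Type*) [TopologicalSpace X] where
  /-- number of double points -/
  numNodes : ℕ
  /-- first preimage of a double point -/
  a : Fin numNodes → X
  /-- second preimage of a double point -/
  b : Fin numNodes → X
  /-- distinct double points have no preimages in common -/
  injective : Function.Injective (Sum.elim a b)
  /-- different components meet -/
  component_ne : ∀ e, connectedComponent (a e) ≠ connectedComponent (b e)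

/-- The preimages in the normalization of the double points. -/
def NodalCurve.singularSet (Γ : NodalCurve X) : Set X := range Γ.a ∪ range Γ.b

/-- A holomorphic involution of `Γ`, given by its lift to the normalization: a holomorphic
involution which sends every pair of glued points to a pair of glued points. (Being continuous, it
permutes the components.) -/
structure NodalCurve.IsHolomorphicInvolution (Γ : NodalCurve X) (σ : X → X) : Prop where
  holomorphic : MDifferentiable 𝓘(ℂ) 𝓘(ℂ) σ
  involutive : Function.Involutive σ
  map_node : ∀ e, ∃ e', s(σ (Γ.a e), σ (Γ.b e)) = s(Γ.a e', Γ.b e')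

/-- `ψ u`, `u ∈ U`, is a family of Baker-Akhiezer sections over `Γ` with
* essential singularities at the points `P j`, with local parameters `w j = 1 / k_j`,
* poles at the points `γ s`, and normalization `ψ (R t) = d t`,
* gluing constants `lam e` at the double points.

The values of `ψ u` at the points of `P` and `γ` carry no information. -/
structure NodalCurve.IsBakerAkhiezerSection (Γ : NodalCurve X)
    {𝕜 : Type*} [RCLike 𝕜] [NormedAlgebra 𝕜 ℂ] {n l r : ℕ}
    (P : Fin n → X) (w : Fin n → X → ℂ) (γ : Fin r → X) (R : Fin l → X) (d : Fin l → ℂ)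
    (lam : Fin Γ.numNodes → ℂ) (U : Set (Fin n → 𝕜)) (ψ : (Fin n → 𝕜) → X → ℂ) : Prop where
  /-- `ψ` is holomorphic away from `P` and `γ` -/
  holomorphic : ∀ u ∈ U, ∀ x, x ∉ range P → x ∉ range γ →
    MDifferentiableAt 𝓘(ℂ) 𝓘(ℂ) (ψ u) x
  /-- `ψ = exp (k_j u^j) (h_j(u) + ξ_j(u) / k_j + ...)` near `P j`; the second factor is a
  holomorphic function `F` near `P j` -/
  essential : ∀ u ∈ U, ∀ j, ∃ F : X → ℂ,
    (∀ᶠ x in 𝓝 (P j), MDifferentiableAt 𝓘(ℂ) 𝓘(ℂ) F x) ∧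
    ∀ᶠ x in 𝓝[≠] (P j), ψ u x = Complex.exp ((w j x)⁻¹ * algebraMap 𝕜 ℂ (u j)) * F x
  /-- `ψ` has (at most) simple poles at `γ` -/
  pole : ∀ u ∈ U, ∀ s, IsMeromorphicAt (ψ u) (γ s) ∧ (-1 : WithTop ℤ) ≤ order (ψ u) (γ s)
  /-- normalization; `d` does not depend on `u` -/
  normalization : ∀ u ∈ U, ∀ t, ψ u (R t) = d t
  /-- twisted gluing at the double points; `lam` does not depend on `u` -/
  gluing : ∀ u ∈ U, ∀ e, ψ u (Γ.a e) = lam e * ψ u (Γ.b e)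
  /-- `ψ` is differentiable in the parameters `u` -/
  differentiable : ∀ u ∈ U, ∀ x, x ∉ range P → x ∉ range γ →
    DifferentiableAt 𝕜 (fun v => ψ v x) u
  /-- and the derivative in `u` is continuous in `u` and the point of the curve -/
  continuous_fderiv : ContinuousOn
    (fun q : (Fin n → 𝕜) × X => fderiv 𝕜 (fun v => ψ v q.2) q.1)
    (U ×ˢ (range P ∪ range γ)ᶜ)

end Riemann

/-- The partial derivative with respect to the `i`-th coordinate. -/
def partialDeriv {𝕜 : Type*} [RCLike 𝕜] [NormedAlgebra 𝕜 ℂ] {n : ℕ} (i : Fin n)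
    (f : (Fin n → 𝕜) → ℂ) (u : Fin n → 𝕜) : ℂ :=
  fderiv 𝕜 f u (Pi.single i 1)

end SpectralCurve

end

namespace SpectralCurve

open MeasureTheory Metric

/-! ### Plane residues -/

/-! Fix `u` and `i ≠ j`, write A_i = ∂ψ/∂uⁱ, and sum the residues of η = A_i · σ^*A_j · Ω over the
normalization. At P_k the exponential factors of A_i and σ^*A_j are inverse to each other, because σ
changes the sign of the local parameter. Differentiating the exponential costs a pole in A_k only,
so for i ≠ j the product has at most a simple pole there, and the zero of Ω removes it. The poles at
γ and σγ are removed by zeros of Ω. Since ψ(R_t) does not depend on u, A_i vanishes on R and σ^*A_j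
on σR, which removes the poles of Ω there. What is left is Q, with residues A_i(Q_k) A_j(Q_k), and
the double points. There the gluing laws multiply A_i · σ^*A_j by λλ_σ, so the condition on the
residues of Ω makes the two residues at each double point cancel. The residue theorem then leaves
exactly the claimed sum.

Two results carry this. The residue theorem `OneForm.IsMeromorphic.sum_residue_eq_zero` is obtained
from area integrals: if f has compact support and is constant near the singularity of g, then ∫ ∂̄f
· g is a multiple of the residue (`integral_dbar_mul_eq_planeResidue`). Applied to a partition of
unity, these integrals add up to zero because ∂̄1 = 0. The second,
`exists_analyticAt_fderiv_of_family`, says that differentiating in u keeps the type of the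
singularities: once ψ is multiplied by a factor making it holomorphic, it is a Cauchy integral over
a fixed circle, which can be differentiated under the integral sign. -/

theorem circleIntegral_eq_planeResidue {g : ℂ → ℂ} {c : ℂ} {R : ℝ}
    (hg : ∀ z ∈ ball c R, z ≠ c → DifferentiableAt ℂ g z) {r : ℝ} (hr : 0 < r) (hrR : r < R) :
    (∮ z in C(c, r), g z) = 2 * (Real.pi : ℂ) * Complex.I * planeResidue g c := by
  -- Cauchy's theorem on an annulus: the integral does not depend on the radius, so the limit
  -- defining `planeResidue` is that of an eventually constant function.
  have key : ∀ s, 0 < s → s ≤ r → (∮ z in C(c, r), g z) = ∮ z in C(c, s), g z := by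
    intro s hs hsr
    apply Complex.circleIntegral_eq_of_differentiable_on_annulus_off_countable hs hsr
      (s := ∅) countable_empty
    · intro z hz
      refine (hg z ?_ ?_).continuousAt.continuousWithinAt
      · exact closedBall_subset_ball hrR hz.1
      · rintro rfl; exact hz.2 (mem_ball_self hs)
    · intro z hz
      refine hg z ?_ ?_
      · exact ball_subset_ball hrR.le hz.1.1
      · rintro rfl; exact hz.1.2 (mem_closedBall_self hs.le)
  have h2 : (2 * (Real.pi : ℂ) * Complex.I) ≠ 0 := by simp [Real.pi_ne_zero]
  have : planeResidue g c = (2 * (Real.pi : ℂ) * Complex.I)⁻¹ * ∮ z in C(c, r), g z := by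
    apply Tendsto.limUnder_eq
    apply tendsto_const_nhds.congr'
    filter_upwards [Ioc_mem_nhdsGT hr] with s hs
    rw [key s hs.1 hs.2]
  rw [this, mul_inv_cancel_left₀ h2]

/-- Cauchy's integral formula on small circles. As `h c = 0` is allowed, removable singularities are
covered too. -/
theorem planeResidue_of_simple_pole {g h : ℂ → ℂ} {c : ℂ} (hh : AnalyticAt ℂ h c)
    (hgh : ∀ᶠ z in 𝓝[≠] c, g z = (z - c)⁻¹ * h z) : planeResidue g c = h c := by
  have h1 : ∀ᶠ z in 𝓝 c, AnalyticAt ℂ h z ∧ (z ≠ c → g z = (z - c)⁻¹ * h z) :=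
    hh.eventually_analyticAt.and (eventually_nhdsWithin_iff.1 hgh)
  obtain ⟨R, hR, hball⟩ := Metric.eventually_nhds_iff_ball.1 h1
  apply Tendsto.limUnder_eq
  apply tendsto_const_nhds.congr'
  filter_upwards [Ioo_mem_nhdsGT hR] with r hr
  have h2 : (∮ z in C(c, r), g z) = ∮ z in C(c, r), (z - c)⁻¹ • h z := by
    apply circleIntegral.integral_congr hr.1.le
    intro z hz
    have hzc : z ≠ c := by
      rintro rfl
      simp at hz
      exact hr.1.ne hz
    exact (hball z (sphere_subset_closedBall.trans (closedBall_subset_ball hr.2) hz)).2 hzc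
  rw [h2, Complex.circleIntegral_sub_center_inv_smul_of_differentiable_on_off_countable hr.1
    (s := ∅) countable_empty]
  · have h2 : (2 * (Real.pi : ℂ) * Complex.I) ≠ 0 := by simp [Real.pi_ne_zero]
    rw [smul_eq_mul, inv_mul_cancel_left₀ h2]
  · intro z hz
    exact (hball z (closedBall_subset_ball hr.2 hz)).1.continuousAt.continuousWithinAt
  · intro z hz
    exact (hball z (ball_subset_ball hr.2.le hz.1)).1.differentiableAt

/-! ### The Cauchy-Riemann operator -/

/-- Twice the Cauchy-Riemann operator. -/
noncomputable def dbar (f : ℂ → ℂ) (z : ℂ) : ℂ :=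
  fderiv ℝ f z 1 + Complex.I * fderiv ℝ f z Complex.I

theorem dbar_congr {f g : ℂ → ℂ} {z : ℂ} (h : f =ᶠ[𝓝 z] g) : dbar f z = dbar g z := by
  simp only [dbar, h.fderiv_eq]

theorem dbar_const (k z : ℂ) : dbar (fun _ => k) z = 0 := by
  simp [dbar]

theorem dbar_sum {ι : Type*} (s : Finset ι) {f : ι → ℂ → ℂ} {z : ℂ}
    (hf : ∀ i ∈ s, DifferentiableAt ℝ (f i) z) :
    dbar (fun w => ∑ i ∈ s, f i w) z = ∑ i ∈ s, dbar (f i) z := by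
  simp [dbar, fderiv_fun_sum hf, Finset.sum_add_distrib, Finset.mul_sum]

theorem clm_apply_eq (L : ℂ →L[ℝ] ℂ) (w : ℂ) :
    L w = w.re * L 1 + w.im * L Complex.I := by
  have h : w = w.re • (1 : ℂ) + w.im • Complex.I := by
    simp [Complex.re_add_im]
  conv_lhs => rw [h, map_add, map_smul, map_smul]
  simp only [Complex.real_smul]

/-- The conjugate of T' appearing here and the factor T' from a change of chart in a 1-form together
make the Jacobian |T'|², so ∂̄f ∧ η can be integrated in any chart. -/
theorem dbar_comp {f T : ℂ → ℂ} {z : ℂ} (hf : DifferentiableAt ℝ f (T z))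
    (hT : DifferentiableAt ℂ T z) :
    dbar (f ∘ T) z = dbar f (T z) * (starRingEnd ℂ) (deriv T z) := by
  have h1 : HasFDerivAt T ((fderiv ℂ T z).restrictScalars ℝ) z :=
    hT.hasFDerivAt.restrictScalars ℝ
  have h2 := (hf.hasFDerivAt.comp z h1).fderiv
  have h3 : ∀ v, fderiv ℂ T z v = v * deriv T z := fun v => by
    rw [fderiv_eq_smul_deriv, smul_eq_mul]
  simp only [dbar, h2, ContinuousLinearMap.comp_apply, ContinuousLinearMap.coe_restrictScalars', h3]
  rw [clm_apply_eq (fderiv ℝ f (T z)) (1 * deriv T z),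
    clm_apply_eq (fderiv ℝ f (T z)) (Complex.I * deriv T z)]
  have h4 : (starRingEnd ℂ) (deriv T z) = (deriv T z).re - (deriv T z).im * Complex.I := by
    apply Complex.ext <;> simp
  rw [h4]
  simp
  linear_combination (((deriv T z).im : ℂ) * (fderiv ℝ f (T z)) Complex.I) * Complex.I_mul_I

theorem dbar_mul_holomorphic {f g : ℂ → ℂ} {z : ℂ} (hf : DifferentiableAt ℝ f z)
    (hg : DifferentiableAt ℂ g z) : dbar (fun w => f w * g w) z = dbar f z * g z := by
  have h1 : HasFDerivAt g ((fderiv ℂ g z).restrictScalars ℝ) z :=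
    hg.hasFDerivAt.restrictScalars ℝ
  have h3 : ∀ v, fderiv ℂ g z v = v * deriv g z := fun v => by
    rw [fderiv_eq_smul_deriv, smul_eq_mul]
  have h2 := (hf.hasFDerivAt.mul h1).fderiv
  simp only [dbar]
  change fderiv ℝ (f * g) z 1 + Complex.I * fderiv ℝ (f * g) z Complex.I = _
  rw [h2]
  simp [h3]
  linear_combination (f z * deriv g z) * Complex.I_mul_I

/-- Integration by parts against the constant function 1. -/
theorem integral_fderiv_apply_eq_zero {f : ℂ → ℂ} (hf : ContDiff ℝ 1 f)
    (hc : HasCompactSupport f) (v : ℂ) : ∫ z, fderiv ℝ f z v = 0 := by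
  have hi : Integrable (fun z => fderiv ℝ f z v) :=
    ((hf.continuous_fderiv one_ne_zero).clm_apply continuous_const).integrable_of_hasCompactSupport
      (hc.fderiv_apply ℝ v)
  have := integral_mul_fderiv_eq_neg_fderiv_mul_of_integrable (μ := (volume : Measure ℂ))
    (f := fun _ : ℂ => (1 : ℂ)) (g := f) (v := v) (by simp) (by simpa using hi)
    (by simpa using hf.continuous.integrable_of_hasCompactSupport hc)
    (fun _ _ => by fun_prop) (fun z _ => hf.differentiable one_ne_zero z)
  simpa using this

theorem integrable_fderiv_apply {f : ℂ → ℂ} (hf : ContDiff ℝ 1 f)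
    (hc : HasCompactSupport f) (v : ℂ) : Integrable (fun z => fderiv ℝ f z v) :=
  ((hf.continuous_fderiv one_ne_zero).clm_apply continuous_const).integrable_of_hasCompactSupport
      (hc.fderiv_apply ℝ v)

theorem integral_dbar_eq_zero {f : ℂ → ℂ} (hf : ContDiff ℝ 1 f)
    (hc : HasCompactSupport f) : ∫ z, dbar f z = 0 := by
  simp only [dbar]
  rw [integral_add (integrable_fderiv_apply hf hc 1)
    ((integrable_fderiv_apply hf hc _).const_mul _), integral_const_mul,
    integral_fderiv_apply_eq_zero hf hc, integral_fderiv_apply_eq_zero hf hc]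
  simp

theorem contDiff_mul_of_tsupport {f g : ℂ → ℂ} (hf : ContDiff ℝ 1 f)
    (hg : ∀ z ∈ tsupport f, AnalyticAt ℂ g z) : ContDiff ℝ 1 (fun z => f z * g z) := by
  rw [contDiff_iff_contDiffAt]
  intro z
  by_cases hz : z ∈ tsupport f
  · exact hf.contDiffAt.mul ((hg z hz).contDiffAt.restrict_scalars ℝ)
  · have h0 : (fun z => f z * g z) =ᶠ[𝓝 z] fun _ => 0 := by
      filter_upwards [notMem_tsupport_iff_eventuallyEq.1 hz] with w hw
      simp [hw]
    exact contDiffAt_const.congr_of_eventuallyEq h0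

theorem dbar_eq_zero_of_notMem_tsupport {f : ℂ → ℂ} {z : ℂ} (hz : z ∉ tsupport f) :
    dbar f z = 0 := by
  rw [dbar_congr (notMem_tsupport_iff_eventuallyEq.1 hz)]
  exact dbar_const 0 z

/-- Stokes: as g is holomorphic on the support of f, the integrand is ∂̄(fg) with fg compactly
supported. -/
theorem integral_dbar_mul_eq_zero {f g : ℂ → ℂ} (hf : ContDiff ℝ 1 f) (hc : HasCompactSupport f)
    (hg : ∀ z ∈ tsupport f, AnalyticAt ℂ g z) : ∫ z, dbar f z * g z = 0 := by
  rw [← integral_dbar_eq_zero (contDiff_mul_of_tsupport hf hg) hc.mul_right]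
  congr 1
  ext z
  by_cases hz : z ∈ tsupport f
  · rw [dbar_mul_holomorphic (hf.differentiable one_ne_zero z) (hg z hz).differentiableAt]
  · rw [dbar_eq_zero_of_notMem_tsupport hz, zero_mul, dbar_eq_zero_of_notMem_tsupport]
    exact fun h => hz (tsupport_mul_subset_left h)

theorem continuous_dbar {f : ℂ → ℂ} (hf : ContDiff ℝ 1 f) : Continuous (dbar f) := by
  have h := fun v : ℂ => (hf.continuous_fderiv one_ne_zero).clm_apply (continuous_const (y := v))
  exact (h 1).add (continuous_const.mul (h _))

end SpectralCurve

namespace SpectralCurve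

open MeasureTheory Metric

/-! ### Radial cutoff functions -/

/-- A smooth function of `s` equal to `1` for `s ≤ a / 2` and to `0` for `s ≥ a`. -/
noncomputable def cutoffProfile (a s : ℝ) : ℝ := Real.smoothTransition (2 - 2 * s / a)

theorem contDiff_cutoffProfile (a : ℝ) : ContDiff ℝ ∞ (cutoffProfile a) := by
  unfold cutoffProfile
  exact Real.smoothTransition.contDiff.comp (by fun_prop)

theorem cutoffProfile_eq_one {a s : ℝ} (ha : 0 < a) (hs : s ≤ a / 2) : cutoffProfile a s = 1 := by
  apply Real.smoothTransition.one_of_one_le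
  have : 2 * s / a ≤ 1 := by rw [div_le_one ha]; linarith
  linarith

theorem cutoffProfile_eq_zero {a s : ℝ} (ha : 0 < a) (hs : a ≤ s) : cutoffProfile a s = 0 := by
  apply Real.smoothTransition.zero_of_nonpos
  have : 2 ≤ 2 * s / a := by rw [le_div_iff₀ ha]; linarith
  linarith

theorem deriv_cutoffProfile_of_lt {a s : ℝ} (ha : 0 < a) (hs : s < a / 2) :
    deriv (cutoffProfile a) s = 0 := by
  have : cutoffProfile a =ᶠ[𝓝 s] fun _ => 1 := by
    filter_upwards [Iio_mem_nhds hs] with t ht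
    exact cutoffProfile_eq_one ha (le_of_lt ht)
  rw [this.deriv_eq, deriv_const]

theorem deriv_cutoffProfile_of_gt {a s : ℝ} (ha : 0 < a) (hs : a < s) :
    deriv (cutoffProfile a) s = 0 := by
  have : cutoffProfile a =ᶠ[𝓝 s] fun _ => 0 := by
    filter_upwards [Ioi_mem_nhds hs] with t ht
    exact cutoffProfile_eq_zero ha (le_of_lt ht)
  rw [this.deriv_eq, deriv_const]

/-- A smooth function equal to `1` near `c` and supported in the disc of radius `√a`. -/
noncomputable def radialCutoff (c : ℂ) (a : ℝ) (z : ℂ) : ℂ := (cutoffProfile a (‖z - c‖ ^ 2) : ℝ)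

/-- The profile is evaluated at the squared distance, which is smooth at `c` as well. -/
theorem contDiff_radialCutoff (c : ℂ) (a : ℝ) : ContDiff ℝ ∞ (radialCutoff c a) := by
  unfold radialCutoff
  exact Complex.ofRealCLM.contDiff.comp ((contDiff_cutoffProfile a).comp
    ((contDiff_id.sub contDiff_const).norm_sq ℝ))

theorem radialCutoff_eq_one {c : ℂ} {a : ℝ} (ha : 0 < a) :
    ∀ᶠ z in 𝓝 c, radialCutoff c a z = 1 := by
  have hc : ContinuousAt (fun z : ℂ => ‖z - c‖ ^ 2) c := by fun_prop
  have := hc.eventually_lt (continuousAt_const (y := a / 2)) (by simp; positivity)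
  filter_upwards [this] with z hz
  simp [radialCutoff, cutoffProfile_eq_one ha hz.le]

theorem tsupport_radialCutoff_subset {c : ℂ} {r : ℝ} (hr : 0 < r) :
    tsupport (radialCutoff c (r ^ 2)) ⊆ closedBall c r := by
  apply closure_minimal _ isClosed_closedBall
  intro z hz
  by_contra h
  apply hz
  rw [mem_closedBall, dist_eq_norm, not_le] at h
  have : r ^ 2 ≤ ‖z - c‖ ^ 2 := by gcongr
  simp [radialCutoff, cutoffProfile_eq_zero (by positivity) this]

theorem hasCompactSupport_radialCutoff {c : ℂ} {r : ℝ} (hr : 0 < r) :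
    HasCompactSupport (radialCutoff c (r ^ 2)) :=
  (isCompact_closedBall c r).of_isClosed_subset (isClosed_tsupport _)
    (tsupport_radialCutoff_subset hr)

theorem dbar_radialCutoff (c : ℂ) (a : ℝ) (z : ℂ) :
    dbar (radialCutoff c a) z = (2 * deriv (cutoffProfile a) (‖z - c‖ ^ 2) : ℝ) * (z - c) := by
  have h1 : HasFDerivAt (fun w : ℂ => ‖w - c‖ ^ 2) _ z :=
    (HasFDerivAt.norm_sq ((hasFDerivAt_id z).sub_const c))
  have h2 := (((contDiff_cutoffProfile a).differentiable (by simp)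
    (‖z - c‖ ^ 2)).hasDerivAt.comp_hasFDerivAt z h1)
  have h3 := Complex.ofRealCLM.hasFDerivAt.comp z h2
  have h4 : fderiv ℝ (radialCutoff c a) z = _ := h3.fderiv
  simp only [dbar, h4]
  simp [Complex.inner]
  apply Complex.ext <;> simp <;> ring

/-- In polar coordinates the angular integral is a contour integral, equal to 2π times the residue
whatever the radius; the radial integral of the derivative of the profile is 0 - 1. -/
theorem integral_dbar_radialCutoff_mul {c : ℂ} {r R : ℝ} (hr : 0 < r) (hrR : r < R) {g : ℂ → ℂ}
    (hg : ∀ z ∈ ball c R, z ≠ c → DifferentiableAt ℂ g z) :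
    ∫ z, dbar (radialCutoff c (r ^ 2)) z * g z = -(2 * Real.pi) * planeResidue g c := by
  set E : ℝ → ℝ := cutoffProfile (r ^ 2) with hE
  have ha : 0 < r ^ 2 := by positivity
  -- The polar Jacobian is included: the first factor is the derivative of ρ ↦ E(ρ²).
  set G : ℝ × ℝ → ℂ := fun p => ((2 * p.1 * deriv E (p.1 ^ 2) : ℝ) : ℂ) *
    (circleMap 0 p.1 p.2 * g (circleMap c p.1 p.2)) with hG
  have hpolar : ∫ z, dbar (radialCutoff c (r ^ 2)) z * g z =
      ∫ p in Ioi (0 : ℝ) ×ˢ Ioo (-Real.pi) Real.pi, G p := by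
    rw [← integral_add_right_eq_self _ c, ← Complex.integral_comp_polarCoord_symm]
    rw [polarCoord_target]
    refine setIntegral_congr_fun (measurableSet_Ioi.prod measurableSet_Ioo) ?_
    rintro ⟨ρ, θ⟩ ⟨hρ, -⟩
    simp only [mem_Ioi] at hρ
    have h1 : Complex.polarCoord.symm (ρ, θ) = circleMap 0 ρ θ := by
      simp [Complex.polarCoord_symm_apply, circleMap, Complex.exp_mul_I]
    have h2 : circleMap 0 ρ θ + c = circleMap c ρ θ := by simp [circleMap, add_comm]
    simp only [h1, dbar_radialCutoff, h2, circleMap_sub_center, norm_circleMap_zero, sq_abs, hG,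
      Complex.real_smul]
    push_cast
    ring
  have hder : ∀ ρ : ℝ, HasDerivAt (fun ρ => E (ρ ^ 2)) (2 * ρ * deriv E (ρ ^ 2)) ρ := by
    intro ρ
    have := (((contDiff_cutoffProfile (r ^ 2)).differentiable (by simp)
      (ρ ^ 2)).hasDerivAt.comp ρ (hasDerivAt_pow 2 ρ))
    refine this.congr_deriv ?_
    simp only [Nat.cast_ofNat, Nat.add_one_sub_one, pow_one]
    ring
  have hint : IntegrableOn G (Ioi (0 : ℝ) ×ˢ Ioo (-Real.pi) Real.pi) := by
    -- The singularity of `g` at the centre does no harm: E' vanishes at ρ² unless r/2 ≤ ρ ≤ r, and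
    -- on this annulus `g` is continuous.
    have hK : IntegrableOn G (Icc (r / 2) r ×ˢ Icc (-Real.pi) Real.pi) := by
      apply ContinuousOn.integrableOn_compact (isCompact_Icc.prod isCompact_Icc)
      have hcont : Continuous (fun p : ℝ × ℝ => circleMap c p.1 p.2) := by
        unfold circleMap; fun_prop
      apply ContinuousOn.mul
      · have := (contDiff_cutoffProfile (r ^ 2)).continuous_deriv (by simp)
        fun_prop
      · apply ContinuousOn.mul
        · apply Continuous.continuousOn; unfold circleMap; fun_prop
        · intro p hp
          have hp1 : 0 < p.1 := by have := hp.1.1; linarith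
          refine ContinuousAt.comp_continuousWithinAt (f := fun p : ℝ × ℝ => circleMap c p.1 p.2)
            (hg _ ?_ ?_).continuousAt hcont.continuousAt.continuousWithinAt
          · simp only [mem_ball, dist_eq_norm, circleMap_sub_center, norm_circleMap_zero,
              abs_of_pos hp1]
            exact hp.1.2.trans_lt hrR
          · exact circleMap_ne_center hp1.ne'
    refine hK.of_forall_sdiff_eq_zero (measurableSet_Ioi.prod measurableSet_Ioo) ?_
    rintro ⟨ρ, θ⟩ ⟨⟨hρ, hθ⟩, hn⟩
    simp only [mem_Ioi] at hρ
    have hE0 : deriv E (ρ ^ 2) = 0 := by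
      rcases lt_or_ge ρ (r / 2) with h | h
      · apply deriv_cutoffProfile_of_lt ha
        nlinarith
      · rcases lt_or_ge r ρ with h' | h'
        · apply deriv_cutoffProfile_of_gt ha
          nlinarith
        · exact absurd ⟨⟨h, h'⟩, Ioo_subset_Icc_self hθ⟩ hn
    simp [hG, hE0]
  rw [Measure.volume_eq_prod] at hint
  rw [hpolar, Measure.volume_eq_prod, setIntegral_prod _ hint]
  have hinner : ∀ ρ ∈ Ioi (0 : ℝ), ∫ θ in Ioo (-Real.pi) Real.pi, G (ρ, θ) =
      ((2 * ρ * deriv E (ρ ^ 2) : ℝ) : ℂ) * (2 * Real.pi * planeResidue g c) := by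
    intro ρ hρ
    simp only [mem_Ioi] at hρ
    simp only [hG]
    rw [integral_const_mul]
    rcases lt_or_ge r ρ with h' | h'
    · have : deriv E (ρ ^ 2) = 0 := by
        apply deriv_cutoffProfile_of_gt ha
        nlinarith
      simp [this]
    congr 1
    rw [← integral_Ioc_eq_integral_Ioo, ← intervalIntegral.integral_of_le
      (by linarith [Real.pi_pos])]
    -- Periodicity moves the angular range (-π, π) of polar coordinates to the range (0, 2π) of
    -- circle integrals.
    have hper : Function.Periodic (fun θ => circleMap 0 ρ θ * g (circleMap c ρ θ))
        (2 * Real.pi) := by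
      intro θ
      simp only [periodic_circleMap 0 ρ θ, periodic_circleMap c ρ θ]
    have h1 := hper.intervalIntegral_add_eq (-Real.pi) 0
    rw [show -Real.pi + 2 * Real.pi = Real.pi by ring, zero_add] at h1
    rw [h1]
    have h2 := circleIntegral_eq_planeResidue hg hρ (h'.trans_lt hrR)
    simp only [circleIntegral, deriv_circleMap, smul_eq_mul] at h2
    have h3 : ∀ θ, circleMap 0 ρ θ * Complex.I * g (circleMap c ρ θ) =
      Complex.I * (circleMap 0 ρ θ * g (circleMap c ρ θ)) := fun θ => by ring
    simp only [h3] at h2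
    rw [intervalIntegral.integral_const_mul] at h2
    apply mul_left_cancel₀ Complex.I_ne_zero
    rw [h2]; ring
  rw [setIntegral_congr_fun measurableSet_Ioi hinner, integral_mul_const, integral_complex_ofReal]
  have hE1 : ContDiff ℝ 1 (fun ρ : ℝ => E (ρ ^ 2)) :=
    ((contDiff_cutoffProfile (r ^ 2)).of_le (by simp)).comp (by fun_prop)
  have hEc : HasCompactSupport (fun ρ : ℝ => E (ρ ^ 2)) := by
    apply HasCompactSupport.of_support_subset_isCompact (isCompact_Icc (a := -r) (b := r))
    intro ρ hρ
    by_contra h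
    apply hρ
    apply cutoffProfile_eq_zero ha
    rw [← sq_abs ρ]
    rw [mem_Icc, ← abs_le, not_le] at h
    gcongr
  have h5 := hEc.integral_Ioi_deriv_eq hE1 0
  simp only [(hder _).deriv] at h5
  rw [h5]
  have : E (0 ^ 2) = 1 := cutoffProfile_eq_one ha (by
    simp only [ne_eq, OfNat.ofNat_ne_zero, not_false_eq_true, zero_pow]; positivity)
  rw [this]
  push_cast
  ring

/-- Where f is constant, ∂̄f vanishes; so the integrand is zero near the singularity of g and
continuous everywhere. -/
theorem integrable_dbar_mul {f g : ℂ → ℂ} {c k : ℂ} (hf : ContDiff ℝ 1 f)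
    (hc : HasCompactSupport f) (hfk : ∀ᶠ z in 𝓝 c, f z = k)
    (hg : ∀ z ∈ tsupport f, z ≠ c → AnalyticAt ℂ g z) :
    Integrable (fun z => dbar f z * g z) := by
  apply Continuous.integrable_of_hasCompactSupport
  · rw [continuous_iff_continuousAt]
    intro z
    by_cases hz : z = c
    · subst hz
      apply (continuousAt_const (y := (0 : ℂ))).congr
      filter_upwards [hfk.eventually_nhds] with w hw
      rw [dbar_congr (g := fun _ => k) hw, dbar_const, zero_mul]
    by_cases hz' : z ∈ tsupport f
    · exact (continuous_dbar hf).continuousAt.mul (hg z hz' hz).continuousAt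
    · apply (continuousAt_const (y := (0 : ℂ))).congr
      filter_upwards [(isClosed_tsupport f).isOpen_compl.mem_nhds hz'] with w hw
      rw [dbar_eq_zero_of_notMem_tsupport hw, zero_mul]
  · apply HasCompactSupport.intro hc
    intro z hz
    rw [dbar_eq_zero_of_notMem_tsupport hz, zero_mul]

/-- The residue as an area integral. -/
theorem integral_dbar_mul_eq_planeResidue {f g : ℂ → ℂ} {c k : ℂ} (hf : ContDiff ℝ 1 f)
    (hc : HasCompactSupport f) (hfk : ∀ᶠ z in 𝓝 c, f z = k)
    (hg : ∀ z ∈ tsupport f, z ≠ c → AnalyticAt ℂ g z) :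
    ∫ z, dbar f z * g z = -(2 * Real.pi) * k * planeResidue g c := by
  -- Holomorphy of `g` is known only on the support of `f`. If `k = 0`, the point `c` is not in it.
  -- Otherwise it contains a disc around `c`, and subtracting `k` times a radial cutoff reduces to a
  -- function vanishing near `c`.
  by_cases hk : k = 0
  · rw [hk, mul_zero, zero_mul]
    apply integral_dbar_mul_eq_zero hf hc
    intro z hz
    refine hg z hz ?_
    rintro rfl
    rw [hk] at hfk
    exact (notMem_tsupport_iff_eventuallyEq.2 hfk) hz
  · obtain ⟨R, hR, hball⟩ := Metric.eventually_nhds_iff_ball.1 hfk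
    have hsub : ∀ z ∈ ball c R, z ∈ tsupport f := fun z hz =>
      subset_tsupport _ (by rw [Function.mem_support, hball z hz]; exact hk)
    set r := R / 2 with hr
    have hr0 : 0 < r := by positivity
    have hrR : r < R := by linarith
    set χ := radialCutoff c (r ^ 2) with hχ
    have hχ1 : ContDiff ℝ 1 χ := (contDiff_radialCutoff c (r ^ 2)).of_le (by simp)
    have hχc : HasCompactSupport χ := hasCompactSupport_radialCutoff hr0
    have hχs : tsupport χ ⊆ ball c R :=
      (tsupport_radialCutoff_subset hr0).trans (closedBall_subset_ball hrR)
    have h1 := integral_dbar_radialCutoff_mul hr0 hrR (g := g)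
      (fun z hz hzc => (hg z (hsub z hz) hzc).differentiableAt)
    have hd : ∀ z, dbar (fun w => f w - k * χ w) z = dbar f z - k * dbar χ z := by
      intro z
      have hfz := hf.differentiable one_ne_zero z
      have hχz := hχ1.differentiable one_ne_zero z
      simp only [dbar]
      rw [fderiv_fun_sub hfz (hχz.const_mul k), fderiv_const_mul hχz]
      simp only [sub_apply, smul_apply, smul_eq_mul]
      ring
    have hzero : ∀ᶠ z in 𝓝 c, f z - k * χ z = 0 := by
      filter_upwards [hfk, radialCutoff_eq_one (c := c) (by positivity : 0 < r ^ 2)] with z h1 h2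
      rw [h1, hχ, h2]; ring
    have hF1 : ContDiff ℝ 1 (fun w => f w - k * χ w) := hf.sub (contDiff_const.mul hχ1)
    have hFc : HasCompactSupport (fun w => f w - k * χ w) := hc.sub hχc.mul_left
    have hFs : tsupport (fun w => f w - k * χ w) ⊆ tsupport f := by
      apply closure_minimal _ (isClosed_tsupport f)
      intro z hz
      by_contra h
      apply hz
      have h0 : χ z = 0 := by
        by_contra h'
        exact h (hsub z (hχs (subset_tsupport _ h')))
      simp [h0, image_eq_zero_of_notMem_tsupport h]
    have h2 : ∫ z, dbar (fun w => f w - k * χ w) z * g z = 0 := by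
      apply integral_dbar_mul_eq_zero hF1 hFc
      intro z hz
      refine hg z (hFs hz) ?_
      rintro rfl
      exact (notMem_tsupport_iff_eventuallyEq.2 hzero) hz
    have hkey : ∀ z, dbar f z * g z =
        dbar (fun w => f w - k * χ w) z * g z + k * (dbar χ z * g z) := by
      intro z; rw [hd]; ring
    simp only [hkey]
    rw [integral_add, h2, integral_const_mul, h1]
    · ring
    · refine integrable_dbar_mul hF1 hFc hzero (fun z hz => hg z (hFs hz))
    · refine (integrable_dbar_mul hχ1 hχc (radialCutoff_eq_one (by positivity)) ?_).const_mul _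
      exact fun z hz => hg z (hsub z (hχs hz))

end SpectralCurve

namespace SpectralCurve

/-! ### Changes of chart for functions and 1-forms -/

section Charts

variable {X : Type*} [TopologicalSpace X] [ChartedSpace ℂ X] [IsManifold 𝓘(ℂ) ω X]

theorem chart_symm_mdifferentiableAt {x : X} {z : ℂ} (hz : z ∈ (chartAt ℂ x).target) :
    MDifferentiableAt 𝓘(ℂ) 𝓘(ℂ) (chartAt ℂ x).symm z :=
  mdifferentiableAt_atlas_symm (chart_mem_atlas ℂ x) hz

theorem differentiableAt_comp_chart_symm {f : X → ℂ} {x : X} {z : ℂ}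
    (hz : z ∈ (chartAt ℂ x).target) (hf : MDifferentiableAt 𝓘(ℂ) 𝓘(ℂ) f ((chartAt ℂ x).symm z)) :
    DifferentiableAt ℂ (f ∘ (chartAt ℂ x).symm) z :=
  mdifferentiableAt_iff_differentiableAt.1 (hf.comp z (chart_symm_mdifferentiableAt hz))

omit [IsManifold 𝓘(ℂ) ω X] in
theorem eventually_nhds_chart_symm {x : X} {z : ℂ} (hz : z ∈ (chartAt ℂ x).target) {p : X → Prop}
    (hp : ∀ᶠ y in 𝓝 ((chartAt ℂ x).symm z), p y) : ∀ᶠ w in 𝓝 z, p ((chartAt ℂ x).symm w) :=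
  ((chartAt ℂ x).continuousAt_symm hz).eventually hp

omit [IsManifold 𝓘(ℂ) ω X] in
theorem eventually_nhdsNE_chart_symm {x : X} {p : X → Prop}
    (hp : ∀ᶠ y in 𝓝[≠] x, p y) : ∀ᶠ w in 𝓝[≠] (chartAt ℂ x x), p ((chartAt ℂ x).symm w) := by
  have hx := mem_chart_source ℂ x
  have hx' := mem_chart_target ℂ x
  rw [eventually_nhdsWithin_iff] at hp ⊢
  rw [← (chartAt ℂ x).left_inv hx] at hp
  filter_upwards [eventually_nhds_chart_symm hx' hp,
    (chartAt ℂ x).open_target.mem_nhds hx'] with w hw hwt hne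
  rw [(chartAt ℂ x).left_inv hx] at hw
  refine hw ?_
  rintro h
  apply hne
  rw [mem_singleton_iff] at h ⊢
  exact ((chartAt ℂ x).right_inv hwt).symm.trans (congrArg _ h)

theorem analyticAt_comp_chart_symm {f : X → ℂ} {x : X}
    (hf : ∀ᶠ y in 𝓝 x, MDifferentiableAt 𝓘(ℂ) 𝓘(ℂ) f y) :
    AnalyticAt ℂ (f ∘ (chartAt ℂ x).symm) (chartAt ℂ x x) := by
  have hx := mem_chart_source ℂ x
  have hx' := mem_chart_target ℂ x
  rw [Complex.analyticAt_iff_eventually_differentiableAt]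
  rw [← (chartAt ℂ x).left_inv hx] at hf
  filter_upwards [eventually_nhds_chart_symm hx' hf,
    (chartAt ℂ x).open_target.mem_nhds hx'] with w hw hwt
  exact differentiableAt_comp_chart_symm hwt hw

theorem analyticAt_transition {x y : X} {z : ℂ} (hz : z ∈ (chartAt ℂ x).target)
    (hy : (chartAt ℂ x).symm z ∈ (chartAt ℂ y).source) :
    AnalyticAt ℂ (chartAt ℂ y ∘ (chartAt ℂ x).symm) z := by
  rw [Complex.analyticAt_iff_eventually_differentiableAt]
  filter_upwards [(chartAt ℂ x).open_target.mem_nhds hz,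
    eventually_nhds_chart_symm hz ((chartAt ℂ y).open_source.mem_nhds hy)] with w hw hwy
  exact differentiableAt_comp_chart_symm hw (mdifferentiableAt_atlas (chart_mem_atlas ℂ y) hwy)

/-- The chain rule for the local identity between the inverse chart at `x` and the inverse chart at
`y` composed with the transition map. -/
theorem OneForm.coeff_transition (η : OneForm X) {x y : X} {z : ℂ} (hz : z ∈ (chartAt ℂ x).target)
    (hy : (chartAt ℂ x).symm z ∈ (chartAt ℂ y).source) :
    η.coeff x z = η.coeff y ((chartAt ℂ y ∘ (chartAt ℂ x).symm) z) *
      deriv (chartAt ℂ y ∘ (chartAt ℂ x).symm) z := by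
  set T := chartAt ℂ y ∘ (chartAt ℂ x).symm with hT
  have hTz : (chartAt ℂ y).symm (T z) = (chartAt ℂ x).symm z := (chartAt ℂ y).left_inv hy
  have hTt : T z ∈ (chartAt ℂ y).target := (chartAt ℂ y).map_source hy
  have h1 : HasMFDerivAt 𝓘(ℂ) 𝓘(ℂ) T z (fderiv ℂ T z) :=
    (analyticAt_transition hz hy).differentiableAt.hasFDerivAt.hasMFDerivAt
  have h2 := (chart_symm_mdifferentiableAt hTt).hasMFDerivAt
  have h3 := h2.comp z h1
  have h4 : (chartAt ℂ x).symm =ᶠ[𝓝 z] (chartAt ℂ y).symm ∘ T := by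
    filter_upwards [eventually_nhds_chart_symm hz ((chartAt ℂ y).open_source.mem_nhds hy)] with w hw
    exact ((chartAt ℂ y).left_inv hw).symm
  have h5 := (h3.congr_of_eventuallyEq h4).mfderiv
  -- All tangent spaces are definitionally ℂ; forgetting the dependence of the types on the base
  -- point makes the rewriting of base points possible.
  let Dx : ℂ →L[ℂ] ℂ := mfderiv 𝓘(ℂ) 𝓘(ℂ) (chartAt ℂ x).symm z
  let Dy : ℂ →L[ℂ] ℂ := mfderiv 𝓘(ℂ) 𝓘(ℂ) (chartAt ℂ y).symm (T z)
  let F : X → ℂ →L[ℂ] ℂ := η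
  have h6 : Dx = Dy.comp (fderiv ℂ T z) := h5
  change F ((chartAt ℂ x).symm z) (Dx 1) = F ((chartAt ℂ y).symm (T z)) (Dy 1) * deriv T z
  have h7 : fderiv ℂ T z 1 = deriv T z • (1 : ℂ) := by simp
  rw [hTz, h6, ContinuousLinearMap.comp_apply, h7, map_smul, map_smul, smul_eq_mul, mul_comm]

theorem OneForm.analyticAt_coeff_of_analyticAt (η : OneForm X) {x y : X} {z : ℂ}
    (hz : z ∈ (chartAt ℂ x).target) (hy : (chartAt ℂ x).symm z ∈ (chartAt ℂ y).source)
    (h : AnalyticAt ℂ (η.coeff y) (chartAt ℂ y ((chartAt ℂ x).symm z))) :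
    AnalyticAt ℂ (η.coeff x) z := by
  have hT := analyticAt_transition hz hy
  have h1 : AnalyticAt ℂ (fun w => η.coeff y ((chartAt ℂ y ∘ (chartAt ℂ x).symm) w) *
      deriv (chartAt ℂ y ∘ (chartAt ℂ x).symm) w) z :=
    (AnalyticAt.comp_of_eq h hT rfl).mul hT.deriv
  refine h1.congr ?_
  filter_upwards [(chartAt ℂ x).open_target.mem_nhds hz,
    eventually_nhds_chart_symm hz ((chartAt ℂ y).open_source.mem_nhds hy)] with w hw hwy
  exact (η.coeff_transition hw hwy).symm

/-- Outside a finite set, a meromorphic form on a compact surface is holomorphic, including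
its values. -/
theorem OneForm.IsMeromorphic.exists_finset_analyticAt [CompactSpace X] {η : OneForm X}
    (hη : η.IsMeromorphic) :
    ∃ S : Finset X, ∀ y ∉ S, AnalyticAt ℂ (η.coeff y) (chartAt ℂ y y) := by
  have h : ∀ x : X, ∀ᶠ y in 𝓝[≠] x, AnalyticAt ℂ (η.coeff y) (chartAt ℂ y y) := by
    intro x
    have h1 := eventually_nhdsWithin_iff.1 (hη x).eventually_analyticAt
    have h2 := ((chartAt ℂ x).continuousAt (mem_chart_source ℂ x)).eventually h1
    rw [eventually_nhdsWithin_iff]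
    filter_upwards [h2, (chartAt ℂ x).open_source.mem_nhds (mem_chart_source ℂ x)] with y hy hys hne
    apply η.analyticAt_coeff_of_analyticAt (y := x) (mem_chart_target ℂ y)
    · rwa [(chartAt ℂ y).left_inv (mem_chart_source ℂ y)]
    · rw [(chartAt ℂ y).left_inv (mem_chart_source ℂ y)]
      apply hy
      intro heq
      exact hne ((chartAt ℂ x).injOn hys (mem_chart_source ℂ x) heq)
  -- Every point has a neighbourhood in which it is the only possible bad point; the centres of a
  -- finite subcover therefore contain all bad points.
  obtain ⟨t, -, ht⟩ := isCompact_univ.elim_nhds_subcover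
    (fun x : X => {y | y ∈ ({x}ᶜ : Set X) → AnalyticAt ℂ (η.coeff y) (chartAt ℂ y y)})
    (fun x _ => eventually_nhdsWithin_iff.1 (h x))
  refine ⟨t, fun y hy => ?_⟩
  obtain ⟨x, hx, hxy⟩ := mem_iUnion₂.1 (ht (mem_univ y))
  apply hxy
  rintro rfl
  exact hy hx

/-- Needed because smooth partitions of unity live on real manifolds. -/
theorem isManifold_real_of_complex : IsManifold 𝓘(ℝ, ℂ) ∞ X := by
  apply isManifold_of_contDiffOn
  intro e e' he he'
  have h := (contDiffGroupoid ω 𝓘(ℂ)).compatible he he'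
  have h1 := (contDiffGroupoid_le (I := 𝓘(ℂ)) (m := ∞) (n := ω) (by simp)) h
  have h2 := (mem_groupoid_of_pregroupoid.1 h1).1
  have h3 : ContDiffOn ℂ ∞ (e.symm ≫ₕ e') (e.symm ≫ₕ e').source := by
    simpa [contDiffPregroupoid] using h2
  simpa using h3.restrict_scalars ℝ

end Charts

end SpectralCurve

namespace SpectralCurve

open MeasureTheory

/-! ### The residue theorem on a compact Riemann surface -/

section ResidueTheorem

variable {X : Type*} [TopologicalSpace X] [ChartedSpace ℂ X]

/-- A finite smooth partition of unity `r α`, `α ∈ T`, such that `r α` is supported in the chart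
domain around `α`, and `α` is the only point of `S` that may lie in this support. -/
structure IsAdaptedPartition (T S : Finset X) (r : X → X → ℂ) : Prop where
  subset : S ⊆ T
  smooth : ∀ α x, ContDiffOn ℝ 1 (r α ∘ (chartAt ℂ x).symm) (chartAt ℂ x).target
  tsupport_subset : ∀ α, tsupport (r α) ⊆ (chartAt ℂ α).source
  eq_of_mem : ∀ α, ∀ s ∈ S, s ∈ tsupport (r α) → s = α
  sum_eq_one : ∀ x, ∑ α ∈ T, r α x = 1

/-- The partition is subordinate to the chart domains from which all points of `S` but the centre
have been deleted; compactness leaves finitely many non-zero functions. -/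
theorem exists_isAdaptedPartition [IsManifold 𝓘(ℂ) ω X] [T2Space X] [CompactSpace X]
    (S : Finset X) : ∃ T r, IsAdaptedPartition T S r := by
  classical
  have hM : IsManifold 𝓘(ℝ, ℂ) ∞ X := isManifold_real_of_complex
  obtain ⟨ρ, hρ⟩ := SmoothPartitionOfUnity.exists_isSubordinate 𝓘(ℝ, ℂ) (s := (univ : Set X))
    isClosed_univ (fun x : X => (chartAt ℂ x).source \ ((S.erase x : Finset X) : Set X))
    (fun x => (chartAt ℂ x).open_source.sdiff (Finset.finite_toSet _).isClosed)
    (fun x _ => mem_iUnion.2 ⟨x, mem_chart_source ℂ x, by simp⟩)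
  have hfin := ρ.locallyFinite.finite_nonempty_of_compact
  have hts : ∀ α, tsupport (fun x => (ρ α x : ℂ)) ⊆ tsupport (ρ α) := fun α =>
    closure_mono fun x hx => by
      simpa using hx
  refine ⟨hfin.toFinset ∪ S, fun α x => (ρ α x : ℂ), Finset.subset_union_right, ?_, ?_, ?_, ?_⟩
  · intro α x
    have h1 : ContMDiffOn 𝓘(ℝ, ℂ) 𝓘(ℝ) ∞ (ρ α ∘ (chartAt ℂ x).symm) (chartAt ℂ x).target :=
      (ρ α).contMDiff.comp_contMDiffOn contMDiffOn_chart_symm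
    have h2 := (contMDiffOn_iff_contDiffOn.1 h1).of_le (m := 1) (by simp)
    exact Complex.ofRealCLM.contDiff.comp_contDiffOn h2
  · exact fun α => (hts α).trans ((hρ α).trans sdiff_subset)
  · intro α s hs hsα
    have := (hρ α (hts α hsα)).2
    simp only [Finset.mem_coe, Finset.mem_erase, not_and] at this
    by_contra h
    exact this h hs
  · intro x
    have h := ρ.sum_eq_one (mem_univ x)
    rw [finsum_eq_sum_of_support_subset (s := hfin.toFinset ∪ S)] at h
    · exact_mod_cast h
    · intro α hα
      simp only [Finset.coe_union, Finite.coe_toFinset, mem_union, mem_ofPred_eq]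
      exact Or.inl ⟨x, hα⟩

variable {T S : Finset X} {r : X → X → ℂ}

theorem IsAdaptedPartition.eventually_eq_zero (h : IsAdaptedPartition T S r) {s α : X}
    (hs : s ∈ S) (hα : α ≠ s) : ∀ᶠ x in 𝓝 s, r α x = 0 :=
  notMem_tsupport_iff_eventuallyEq.1 fun hh => hα (h.eq_of_mem α s hs hh).symm

/-- Near `s` all other members of the partition vanish, so this one carries the whole sum. -/
theorem IsAdaptedPartition.eventually_eq_one (h : IsAdaptedPartition T S r) {s : X}
    (hs : s ∈ S) : ∀ᶠ x in 𝓝 s, r s x = 1 := by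
  classical
  have h1 : ∀ᶠ x in 𝓝 s, ∀ β ∈ T.erase s, r β x = 0 := by
    rw [Filter.eventually_all_finset]
    exact fun β hβ => h.eventually_eq_zero hs (Finset.ne_of_mem_erase hβ)
  filter_upwards [h1] with x hx
  have h2 := h.sum_eq_one x
  rwa [← Finset.add_sum_erase T _ (h.subset hs), Finset.sum_eq_zero hx, add_zero] at h2

theorem IsAdaptedPartition.eventually_const (h : IsAdaptedPartition T S r) {s : X}
    (hs : s ∈ S) (α : X) : ∃ k, ∀ᶠ x in 𝓝 s, r α x = k := by
  by_cases hα : α = s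
  · subst hα
    exact ⟨1, h.eventually_eq_one hs⟩
  · exact ⟨0, h.eventually_eq_zero hs hα⟩

/-- The expression in the chart around `x` of the area form `∂̄f ∧ η`, up to a constant. -/
noncomputable def chartDensity (η : OneForm X) (f : X → ℂ) (x : X) (z : ℂ) : ℂ :=
  dbar (f ∘ (chartAt ℂ x).symm) z * η.coeff x z

theorem chartDensity_eq_zero_of_notMem_tsupport {η : OneForm X} {f : X → ℂ} {x : X} {z : ℂ}
    (hz : z ∈ (chartAt ℂ x).target) (h : (chartAt ℂ x).symm z ∉ tsupport f) :
    chartDensity η f x z = 0 := by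
  have h1 : f ∘ (chartAt ℂ x).symm =ᶠ[𝓝 z] fun _ => 0 :=
    eventually_nhds_chart_symm hz (p := fun y => f y = 0) (notMem_tsupport_iff_eventuallyEq.1 h)
  rw [chartDensity, dbar_congr h1, dbar_const, zero_mul]

theorem integrableOn_of_compact_support {h : ℂ → ℂ} {t K : Set ℂ} (ht : MeasurableSet t)
    (hK : IsCompact K) (hKt : K ⊆ t) (hc : ∀ z ∈ t, ContinuousAt h z)
    (h0 : ∀ z ∈ t, z ∉ K → h z = 0) : IntegrableOn h t := by
  have h1 : IntegrableOn h K :=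
    ContinuousOn.integrableOn_compact hK fun z hz => (hc z (hKt hz)).continuousWithinAt
  exact h1.of_forall_sdiff_eq_zero ht fun z hz => h0 z hz.1 hz.2

variable [T2Space X] [CompactSpace X] [IsManifold 𝓘(ℂ) ω X]

omit [CompactSpace X] [T2Space X] in
-- At points of `S` the partition is locally constant and the density vanishes nearby; elsewhere η
-- is holomorphic.
theorem IsAdaptedPartition.continuousAt_chartDensity (h : IsAdaptedPartition T S r) {η : OneForm X}
    (hη : ∀ y ∉ S, AnalyticAt ℂ (η.coeff y) (chartAt ℂ y y)) (α x : X) {z : ℂ}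
    (hz : z ∈ (chartAt ℂ x).target) : ContinuousAt (chartDensity η (r α) x) z := by
  classical
  by_cases hs : (chartAt ℂ x).symm z ∈ S
  · obtain ⟨k, hk⟩ := h.eventually_const hs α
    have h1 := (eventually_nhds_chart_symm hz hk).eventually_nhds
    apply (continuousAt_const (y := (0 : ℂ))).congr
    filter_upwards [h1] with w hw
    rw [chartDensity, dbar_congr (f := r α ∘ (chartAt ℂ x).symm) (g := fun _ => k) hw, dbar_const, zero_mul]
  · apply ContinuousAt.mul
    · have h1 := ((h.smooth α x).continuousOn_fderiv_of_isOpen (chartAt ℂ x).open_target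
        le_rfl).continuousAt ((chartAt ℂ x).open_target.mem_nhds hz)
      have h2 := fun v : ℂ => h1.clm_apply (continuousAt_const (y := v))
      exact (h2 1).add (continuousAt_const.mul (h2 _))
    · exact (η.analyticAt_coeff_of_analyticAt hz (mem_chart_source ℂ _) (hη _ hs)).continuousAt

omit [T2Space X] [IsManifold 𝓘(ℂ) ω X] in
theorem isCompact_chart_image {f : X → ℂ} {x : X} (hf : tsupport f ⊆ (chartAt ℂ x).source) :
    IsCompact (chartAt ℂ x '' tsupport f) :=
  (isClosed_tsupport f).isCompact.image_of_continuousOn ((chartAt ℂ x).continuousOn.mono hf)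

omit [T2Space X] [IsManifold 𝓘(ℂ) ω X] [CompactSpace X] in
theorem chart_image_subset_target {f : X → ℂ} {x : X} (hf : tsupport f ⊆ (chartAt ℂ x).source) :
    chartAt ℂ x '' tsupport f ⊆ (chartAt ℂ x).target :=
  image_subset_iff.2 fun _ hy => (chartAt ℂ x).map_source (hf hy)

omit [T2Space X] [IsManifold 𝓘(ℂ) ω X] [CompactSpace X] in
theorem notMem_tsupport_of_notMem_chart_image {f : X → ℂ} {x : X} {z : ℂ}
    (hz : z ∈ (chartAt ℂ x).target) (h : z ∉ chartAt ℂ x '' tsupport f) :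
    (chartAt ℂ x).symm z ∉ tsupport f :=
  fun h' => h ⟨_, h', (chartAt ℂ x).right_inv hz⟩

omit [T2Space X] in
-- Extended by zero from the chart, `r x` is a compactly supported C¹ function on the plane, so the
-- plane formulas apply: it is 1 near `x` when `x ∈ S`, and its support misses `S` otherwise.
theorem IsAdaptedPartition.setIntegral_chartDensity_self (h : IsAdaptedPartition T S r)
    {η : OneForm X} (hη : ∀ y ∉ S, AnalyticAt ℂ (η.coeff y) (chartAt ℂ y y)) (x : X) :
    (x ∈ S → ∫ z in (chartAt ℂ x).target, chartDensity η (r x) x z =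
      -(2 * Real.pi) * η.residue x) ∧
    (x ∉ S → ∫ z in (chartAt ℂ x).target, chartDensity η (r x) x z = 0) := by
  classical
  set e := chartAt ℂ x with he
  set K := e '' tsupport (r x) with hK
  have hKc : IsCompact K := isCompact_chart_image (h.tsupport_subset x)
  have hKt : K ⊆ e.target := chart_image_subset_target (h.tsupport_subset x)
  set f : ℂ → ℂ := e.target.indicator (r x ∘ e.symm) with hf
  have hf_eq : ∀ z ∈ e.target, f =ᶠ[𝓝 z] r x ∘ e.symm := by
    intro z hz
    filter_upwards [e.open_target.mem_nhds hz] with w hw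
    exact indicator_of_mem hw _
  have hf0 : ∀ z ∉ K, f z = 0 := by
    intro z hz
    by_cases hzt : z ∈ e.target
    · rw [hf, indicator_of_mem hzt]
      exact image_eq_zero_of_notMem_tsupport (f := r x) (notMem_tsupport_of_notMem_chart_image hzt hz)
    · exact indicator_of_notMem hzt _
  have hfK : tsupport f ⊆ K :=
    closure_minimal (fun z hz => by_contra fun h' => hz (hf0 z h')) hKc.isClosed
  have hfc : HasCompactSupport f := hKc.of_isClosed_subset (isClosed_tsupport f) hfK
  have hf1 : ContDiff ℝ 1 f := by
    rw [contDiff_iff_contDiffAt]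
    intro z
    by_cases hz : z ∈ e.target
    · exact ((h.smooth x x).contDiffAt (e.open_target.mem_nhds hz)).congr_of_eventuallyEq
        (hf_eq z hz)
    · exact contDiffAt_const.congr_of_eventuallyEq
        (notMem_tsupport_iff_eventuallyEq.1 fun h' => hz (hKt (hfK h')))
  have hint : ∫ z in e.target, chartDensity η (r x) x z = ∫ z, dbar f z * η.coeff x z := by
    rw [← setIntegral_eq_integral_of_forall_compl_eq_zero (s := e.target)
      (f := fun z => dbar f z * η.coeff x z)]
    · refine setIntegral_congr_fun e.open_target.measurableSet fun z hz => ?_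
      simp only [chartDensity]
      rw [dbar_congr (hf_eq z hz)]
    · intro z hz
      rw [dbar_eq_zero_of_notMem_tsupport fun h' => hz (hKt (hfK h')), zero_mul]
  have hga : ∀ z ∈ tsupport f, (e.symm z ∉ S) → AnalyticAt ℂ (η.coeff x) z := fun z hz hs =>
    η.analyticAt_coeff_of_analyticAt (hKt (hfK hz)) (mem_chart_source ℂ _) (hη _ hs)
  have hsupp : ∀ z ∈ tsupport f, e.symm z ∈ tsupport (r x) := by
    intro z hz
    by_contra h'
    exact h' (by_contra fun h'' => by
      obtain ⟨y, hy, rfl⟩ := hfK hz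
      rw [e.left_inv (h.tsupport_subset x hy)] at h''
      exact h'' hy)
  constructor
  · intro hx
    rw [hint, integral_dbar_mul_eq_planeResidue (c := e x) (k := 1) hf1 hfc]
    · rw [mul_one]; rfl
    · have h1 : ∀ᶠ y in 𝓝 (e.symm (e x)), r x y = 1 := by
        rw [e.left_inv (mem_chart_source ℂ x)]
        exact h.eventually_eq_one hx
      have hxt : e x ∈ e.target := mem_chart_target ℂ x
      filter_upwards [eventually_nhds_chart_symm hxt h1, hf_eq _ hxt] with w hw1 hw2
      rw [hw2, Function.comp_apply, hw1]
    · intro z hz hzx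
      apply hga z hz
      intro hs
      apply hzx
      have := h.eq_of_mem x _ hs (hsupp z hz)
      rw [← e.right_inv (hKt (hfK hz)), this]
  · intro hx
    rw [hint]
    apply integral_dbar_mul_eq_zero hf1 hfc
    intro z hz
    apply hga z hz
    intro hs
    exact hx (h.eq_of_mem x _ hs (hsupp z hz) ▸ hs)

/-- A ℂ-linear map of ℂ is multiplication by a number, whose real determinant is the norm from ℂ to
ℝ. -/
theorem det_restrictScalars_fderiv (L : ℂ →L[ℂ] ℂ) :
    |(L.restrictScalars ℝ).det| = Complex.normSq (L 1) := by
  have h1 : ((L.restrictScalars ℝ : ℂ →L[ℝ] ℂ) : ℂ →ₗ[ℝ] ℂ) = Algebra.lmul ℝ ℂ (L 1) := by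
    ext1 v
    have : L (v • (1 : ℂ)) = v • L 1 := map_smul _ _ _
    simpa [mul_comm] using this
  have h2 : (L.restrictScalars ℝ).det = Complex.normSq (L 1) := by
    rw [ContinuousLinearMap.det, h1]
    exact Algebra.norm_complex_apply (L 1)
  rw [h2, abs_of_nonneg (Complex.normSq_nonneg _)]

omit [T2Space X] [CompactSpace X] in
-- Both integrands live on the overlap of the two charts, thanks to `r β` on one side and `r α` on
-- the other. There the change of variables holds because conj(τ') from ∂̄ times τ' from the form is
-- the Jacobian.
theorem IsAdaptedPartition.setIntegral_chartDensity_change (h : IsAdaptedPartition T S r)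
    (η : OneForm X) (α β : X) :
    ∫ z in (chartAt ℂ α).target, r β ((chartAt ℂ α).symm z) * chartDensity η (r α) α z =
      ∫ z in (chartAt ℂ β).target, r β ((chartAt ℂ β).symm z) * chartDensity η (r α) β z := by
  set e := chartAt ℂ α with he
  set e' := chartAt ℂ β with he'
  set τ := e'.symm.trans e with hτ
  have hs : τ.source = e'.target ∩ e'.symm ⁻¹' e.source := by
    rw [hτ, OpenPartialHomeomorph.trans_source]; rfl
  have ht : τ.target = e.target ∩ e.symm ⁻¹' e'.source := by
    rw [hτ, OpenPartialHomeomorph.trans_target]; rfl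
  have h1 : ∫ z in e.target, r β (e.symm z) * chartDensity η (r α) α z =
      ∫ z in τ.target, r β (e.symm z) * chartDensity η (r α) α z := by
    apply setIntegral_eq_of_subset_of_forall_sdiff_eq_zero e.open_target.measurableSet
    · rw [ht]; exact inter_subset_left
    · rintro z ⟨hz, hz'⟩
      rw [image_eq_zero_of_notMem_tsupport (f := r β), zero_mul]
      intro h'
      exact hz' (ht ▸ ⟨hz, h.tsupport_subset β h'⟩)
  have h2 : ∫ z in e'.target, r β (e'.symm z) * chartDensity η (r α) β z =
      ∫ z in τ.source, r β (e'.symm z) * chartDensity η (r α) β z := by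
    apply setIntegral_eq_of_subset_of_forall_sdiff_eq_zero e'.open_target.measurableSet
    · rw [hs]; exact inter_subset_left
    · rintro z ⟨hz, hz'⟩
      rw [chartDensity_eq_zero_of_notMem_tsupport hz, mul_zero]
      intro h'
      exact hz' (hs ▸ ⟨hz, h.tsupport_subset α h'⟩)
  rw [h1, h2, ← τ.image_source_eq_target]
  have hτa : ∀ z ∈ τ.source, AnalyticAt ℂ τ z := fun z hz =>
    analyticAt_transition (hs ▸ hz).1 (hs ▸ hz).2
  rw [integral_image_eq_integral_abs_det_fderiv_smul volume τ.open_source.measurableSet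
    (f' := fun z => (fderiv ℂ τ z).restrictScalars ℝ)
    (fun z hz => ((hτa z hz).differentiableAt.hasFDerivAt.restrictScalars ℝ).hasFDerivWithinAt)
    τ.injOn]
  refine setIntegral_congr_fun τ.open_source.measurableSet fun z hz => ?_
  have hz1 : z ∈ e'.target := (hs ▸ hz).1
  have hz2 : e'.symm z ∈ e.source := (hs ▸ hz).2
  have hτz : e.symm (τ z) = e'.symm z := e.left_inv hz2
  have hd : dbar (r α ∘ e'.symm) z = dbar (r α ∘ e.symm) (τ z) * (starRingEnd ℂ) (deriv τ z) := by
    rw [← dbar_comp _ (hτa z hz).differentiableAt]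
    · apply dbar_congr
      filter_upwards [τ.open_source.mem_nhds hz] with w hw
      have : e.symm (τ w) = e'.symm w := e.left_inv (hs ▸ hw).2
      simp only [Function.comp_apply, this]
    · have := (h.smooth α α).contDiffAt (e.open_target.mem_nhds (e.map_source hz2))
      exact this.differentiableAt one_ne_zero
  have hc : η.coeff β z = η.coeff α (τ z) * deriv τ z := η.coeff_transition hz1 hz2
  simp only [det_restrictScalars_fderiv, chartDensity, ← he, ← he', hd, hc, hτz,
    fderiv_apply_one_eq_deriv, Complex.real_smul]
  rw [Complex.normSq_eq_conj_mul_self]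
  ring

/-- **Residue theorem** on a compact Riemann surface. -/
theorem OneForm.IsMeromorphic.sum_residue_eq_zero {η : OneForm X} (hη : η.IsMeromorphic)
    {ι : Type*} [Fintype ι] {p : ι → X} (hp : Function.Injective p)
    (h0 : ∀ x ∉ range p, η.residue x = 0) : ∑ i, η.residue (p i) = 0 := by
  classical
  obtain ⟨S, hS⟩ := hη.exists_finset_analyticAt
  -- Points of `S` outside the range of `p` have zero residue by `h0`, so enlarging the set does not
  -- change the sum.
  set S' := S ∪ Finset.univ.image p with hS'
  have hη' : ∀ y ∉ S', AnalyticAt ℂ (η.coeff y) (chartAt ℂ y y) := fun y hy =>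
    hS y fun h => hy (Finset.mem_union_left _ h)
  obtain ⟨T, r, h⟩ := exists_isAdaptedPartition S'
  have hsum1 : ∑ x ∈ T, ∫ z in (chartAt ℂ x).target, chartDensity η (r x) x z =
      -(2 * Real.pi) * ∑ i, η.residue (p i) := by
    rw [← Finset.sum_subset h.subset
      fun x _ hx => (h.setIntegral_chartDensity_self hη' x).2 hx,
      Finset.sum_congr rfl fun x hx => (h.setIntegral_chartDensity_self hη' x).1 hx,
      ← Finset.mul_sum, ← Finset.sum_image (s := Finset.univ) (g := p) (f := η.residue)
        fun i _ j _ hij => hp hij]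
    congr 1
    symm
    apply Finset.sum_subset Finset.subset_union_right
    intro x _ hx
    apply h0
    simpa using hx
  have hint : ∀ x α β : X, (x = α ∨ x = β) → IntegrableOn
      (fun z => r β ((chartAt ℂ x).symm z) * chartDensity η (r α) x z) (chartAt ℂ x).target := by
    intro x α β hx
    have hc : ∀ z ∈ (chartAt ℂ x).target, ContinuousAt
        (fun z => r β ((chartAt ℂ x).symm z) * chartDensity η (r α) x z) z := fun z hz =>
      ((h.smooth β x).continuousOn.continuousAt ((chartAt ℂ x).open_target.mem_nhds hz)).mul
        (h.continuousAt_chartDensity hη' α x hz)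
    rcases hx with rfl | rfl
    · apply integrableOn_of_compact_support (chartAt ℂ x).open_target.measurableSet
        (isCompact_chart_image (h.tsupport_subset x))
        (chart_image_subset_target (h.tsupport_subset x)) hc
      intro z hz hzK
      rw [chartDensity_eq_zero_of_notMem_tsupport hz
        (notMem_tsupport_of_notMem_chart_image hz hzK), mul_zero]
    · apply integrableOn_of_compact_support (chartAt ℂ x).open_target.measurableSet
        (isCompact_chart_image (h.tsupport_subset x))
        (chart_image_subset_target (h.tsupport_subset x)) hc
      intro z hz hzK
      rw [image_eq_zero_of_notMem_tsupport
        (notMem_tsupport_of_notMem_chart_image hz hzK), zero_mul]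
  -- Insert 1 = Σ_β r_β, move the (α, β) term to the chart at β, and sum over α first: ∂̄ of Σ_α r_α
  -- = 1 vanishes.
  have hsum2 : ∑ x ∈ T, ∫ z in (chartAt ℂ x).target, chartDensity η (r x) x z = 0 := by
    calc ∑ α ∈ T, ∫ z in (chartAt ℂ α).target, chartDensity η (r α) α z
        = ∑ α ∈ T, ∑ β ∈ T, ∫ z in (chartAt ℂ α).target,
            r β ((chartAt ℂ α).symm z) * chartDensity η (r α) α z := by
          refine Finset.sum_congr rfl fun α _ => ?_
          rw [← integral_finsetSum _ fun β _ => hint α α β (Or.inl rfl)]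
          congr 1
          ext z
          rw [← Finset.sum_mul, h.sum_eq_one, one_mul]
      _ = ∑ β ∈ T, ∑ α ∈ T, ∫ z in (chartAt ℂ β).target,
            r β ((chartAt ℂ β).symm z) * chartDensity η (r α) β z := by
          rw [Finset.sum_comm]
          exact Finset.sum_congr rfl fun β _ => Finset.sum_congr rfl fun α _ =>
            h.setIntegral_chartDensity_change η α β
      _ = 0 := by
          refine Finset.sum_eq_zero fun β _ => ?_
          rw [← integral_finsetSum _ fun α _ => hint β α β (Or.inr rfl)]
          rw [← integral_zero ℂ ℂ (μ := volume.restrict (chartAt ℂ β).target)]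
          refine setIntegral_congr_fun (chartAt ℂ β).open_target.measurableSet fun z hz => ?_
          simp only [chartDensity]
          rw [← Finset.mul_sum, ← Finset.sum_mul, ← dbar_sum]
          · have : (fun w => ∑ α ∈ T, (r α ∘ (chartAt ℂ β).symm) w) = fun _ => 1 := by
              ext w
              exact h.sum_eq_one _
            rw [this, dbar_const, zero_mul, mul_zero]
          · intro α _
            exact ((h.smooth α β).contDiffAt
              ((chartAt ℂ β).open_target.mem_nhds hz)).differentiableAt one_ne_zero
  rw [hsum2] at hsum1
  have : (-(2 * Real.pi) : ℂ) ≠ 0 := by simp [Real.pi_ne_zero]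
  exact (mul_eq_zero.1 hsum1.symm).resolve_left this

end ResidueTheorem

end SpectralCurve

namespace SpectralCurve

open MeasureTheory Metric

/-! ### Removable singularities in families -/

section Families

variable {𝕜 : Type*} [RCLike 𝕜] [NormedAlgebra 𝕜 ℂ] {E : Type*} [NormedAddCommGroup E]
  [NormedSpace 𝕜 E] {U : Set E}

/-- Cauchy's formula for `f` with its value at `c` corrected. The actual value of `f` at `c` is
arbitrary, hence `w ≠ c`. -/
theorem circleIntegral_cauchy_of_removable {f F : ℂ → ℂ} {c : ℂ} {ρ : ℝ}
    (hf : ∀ z ∈ ball c ρ, z ≠ c → DifferentiableAt ℂ f z) (hF : AnalyticAt ℂ F c)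
    (hfF : f =ᶠ[𝓝[≠] c] F) {r : ℝ} (hr : 0 < r) (hrρ : r < ρ) {w : ℂ} (hw : w ∈ ball c r)
    (hwc : w ≠ c) :
    ∮ z in C(c, r), (z - w)⁻¹ • f z = (2 * (Real.pi : ℂ) * Complex.I) * f w := by
  classical
  set g := Function.update f c (F c) with hg
  have hgz : ∀ z, z ≠ c → g z = f z := fun z hz => Function.update_of_ne hz _ _
  have hgF : g =ᶠ[𝓝 c] F := by
    have := eventually_nhdsWithin_iff.1 hfF
    filter_upwards [this] with z hz
    by_cases hzc : z = c
    · rw [hzc, hg, Function.update_self]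
    · rw [hgz z hzc, hz hzc]
  have hd : DifferentiableOn ℂ g (closedBall c r) := by
    intro z hz
    apply DifferentiableAt.differentiableWithinAt
    by_cases hzc : z = c
    · subst hzc
      exact hF.differentiableAt.congr_of_eventuallyEq hgF
    · refine (hf z (closedBall_subset_ball hrρ hz) hzc).congr_of_eventuallyEq ?_
      filter_upwards [isOpen_ne.mem_nhds hzc] with y hy
      exact hgz y hy
  have h1 := hd.circleIntegral_sub_inv_smul hw
  rw [← hgz w hwc, ← smul_eq_mul (b := g w), ← h1]
  refine circleIntegral.integral_congr hr.le fun z hz => ?_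
  have hzc : z ≠ c := by
    rintro rfl
    simp at hz
    exact hr.ne hz
  simp only [hgz z hzc]

theorem hasDerivAt_line {f : E → ℂ} {u e : E} {t : 𝕜} (hf : DifferentiableAt 𝕜 f (u + t • e)) :
    HasDerivAt (fun s : 𝕜 => f (u + s • e)) (fderiv 𝕜 f (u + t • e) e) t := by
  have h1 : HasDerivAt (fun s : 𝕜 => u + s • e) e t := by
    simpa using ((hasDerivAt_id t).smul_const e).const_add u
  exact hf.hasFDerivAt.comp_hasDerivAt t h1

/-- Removability of singularities is inherited by the derivative with respect to a parameter. -/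
theorem exists_analyticAt_fderiv_of_family (hU : IsOpen U) {c : ℂ} {ρ : ℝ} (hρ : 0 < ρ)
    {f : E → ℂ → ℂ} (e : E)
    (hd : ∀ v ∈ U, ∀ z ∈ ball c ρ, z ≠ c → DifferentiableAt ℂ (f v) z)
    (hF : ∀ v ∈ U, ∃ F, AnalyticAt ℂ F c ∧ f v =ᶠ[𝓝[≠] c] F)
    (hu : ∀ v ∈ U, ∀ z ∈ ball c ρ, z ≠ c → DifferentiableAt 𝕜 (fun v => f v z) v)
    (hc : ContinuousOn (fun q : E × ℂ => fderiv 𝕜 (fun v => f v q.2) q.1 e)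
      (U ×ˢ (ball c ρ \ {c}))) {u : E} (huU : u ∈ U) :
    ∃ G, AnalyticAt ℂ G c ∧ (fun z => fderiv 𝕜 (fun v => f v z) u e) =ᶠ[𝓝[≠] c] G := by
  set r := ρ / 2 with hr
  have hr0 : 0 < r := by positivity
  have hrρ : r < ρ := by linarith
  set f' : E → ℂ → ℂ := fun v z => fderiv 𝕜 (fun v => f v z) v e with hf'
  have hsph : sphere c r ⊆ ball c ρ \ {c} := fun z hz =>
    ⟨closedBall_subset_ball hrρ (sphere_subset_closedBall hz), by
      rintro rfl
      simp at hz
      exact hr0.ne hz⟩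
  have hcirc : ∀ θ, circleMap c r θ ∈ sphere c r := circleMap_mem_sphere c hr0.le
  have hline : Continuous (fun t : 𝕜 => u + t • e) := by fun_prop
  obtain ⟨δ, hδ, hδU⟩ : ∃ δ > 0, ∀ t : 𝕜, t ∈ closedBall (0 : 𝕜) δ → u + t • e ∈ U := by
    have : ∀ᶠ t in 𝓝 (0 : 𝕜), u + t • e ∈ U := by
      apply hline.continuousAt.eventually_mem
      simpa using hU.mem_nhds huU
    obtain ⟨δ, hδ, h⟩ := Metric.nhds_basis_closedBall.eventually_iff.1 this
    exact ⟨δ, hδ, fun t ht => h ht⟩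
  -- Joint continuity of the derivative on a compact set gives the dominating bound; the circle
  -- stays away from the singularity.
  obtain ⟨M, hM⟩ : ∃ M, ∀ t ∈ closedBall (0 : 𝕜) δ, ∀ z ∈ sphere c r, ‖f' (u + t • e) z‖ ≤ M := by
    have hK : IsCompact (closedBall (0 : 𝕜) δ ×ˢ sphere c r) :=
      (isCompact_closedBall _ _).prod (isCompact_sphere _ _)
    have hcont : ContinuousOn (fun q : 𝕜 × ℂ => f' (u + q.1 • e) q.2)
        (closedBall (0 : 𝕜) δ ×ˢ sphere c r) := by
      refine hc.comp (f := fun q : 𝕜 × ℂ => (u + q.1 • e, q.2)) (by fun_prop) ?_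
      exact fun q hq => ⟨hδU _ hq.1, hsph hq.2⟩
    obtain ⟨M, hM⟩ := hK.exists_bound_of_continuousOn hcont
    exact ⟨M, fun t ht z hz => hM (t, z) ⟨ht, hz⟩⟩
  have hfc : ∀ v ∈ U, Continuous (fun θ => f v (circleMap c r θ)) := by
    intro v hv
    rw [continuous_iff_continuousAt]
    intro θ
    exact ContinuousAt.comp (hd v hv _ (hsph (hcirc θ)).1 (hsph (hcirc θ)).2).continuousAt
      (continuous_circleMap c r).continuousAt
  have hfc' : Continuous (fun θ => f' u (circleMap c r θ)) := by
    rw [← continuousOn_univ]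
    exact hc.comp (f := fun θ => (u, circleMap c r θ)) (by fun_prop)
      (fun θ _ => ⟨huU, hsph (hcirc θ)⟩)
  -- The extension is the Cauchy integral of the parameter derivative, analytic on the whole disc
  -- whatever happens at `c`.
  refine ⟨fun w => (2 * (Real.pi : ℂ) * Complex.I)⁻¹ • ∮ z in C(c, r), (z - w)⁻¹ • f' u z, ?_, ?_⟩
  · have hci : CircleIntegrable (f' u) c (⟨r, hr0.le⟩ : NNReal) := hfc'.intervalIntegrable _ _
    exact (hasFPowerSeriesOn_cauchy_integral hci hr0).analyticAt
  rw [EventuallyEq, eventually_nhdsWithin_iff]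
  filter_upwards [ball_mem_nhds c hr0] with w hw hwc
  set k : ℝ → ℂ := fun θ => deriv (circleMap c r) θ * (circleMap c r θ - w)⁻¹ with hk
  have hkc : Continuous k := by
    simp only [hk, deriv_circleMap]
    refine Continuous.mul (by fun_prop) (Continuous.inv₀ (by fun_prop) fun θ => ?_)
    exact sub_ne_zero.2 (circleMap_ne_mem_ball hw θ)
  have hD := (intervalIntegral.hasDerivAt_integral_of_dominated_loc_of_deriv_le (𝕜 := 𝕜)
    (μ := volume) (a := 0) (b := 2 * Real.pi)
    (F := fun t θ => k θ * f (u + t • e) (circleMap c r θ))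
    (F' := fun t θ => k θ * f' (u + t • e) (circleMap c r θ)) (x₀ := 0)
    (bound := fun θ => ‖k θ‖ * M)
    (closedBall_mem_nhds (0 : 𝕜) hδ) ?_ ?_ ?_ ?_ ?_ ?_).2
  · have hL : HasDerivAt (fun t : 𝕜 => (2 * (Real.pi : ℂ) * Complex.I) * f (u + t • e) w)
        ((2 * (Real.pi : ℂ) * Complex.I) * f' u w) 0 := by
      have h0 := hasDerivAt_line (f := fun v => f v w) (u := u) (e := e) (t := (0 : 𝕜))
        (hu _ (by simpa using huU) w (ball_subset_ball hrρ.le hw) hwc)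
      simp only [zero_smul, add_zero] at h0
      exact h0.const_mul _
    have hE : (fun t : 𝕜 => ∫ θ in (0)..(2 * Real.pi), k θ * f (u + t • e) (circleMap c r θ))
        =ᶠ[𝓝 0] fun t : 𝕜 => (2 * (Real.pi : ℂ) * Complex.I) * f (u + t • e) w := by
      filter_upwards [closedBall_mem_nhds (0 : 𝕜) hδ] with t ht
      obtain ⟨F, hFa, hFe⟩ := hF _ (hδU t ht)
      rw [← circleIntegral_cauchy_of_removable (hd _ (hδU t ht)) hFa hFe hr0 hrρ hw hwc]
      simp only [circleIntegral, hk, smul_eq_mul, mul_assoc]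
    have h1 := (hL.congr_of_eventuallyEq hE).unique hD
    simp only [zero_smul, add_zero] at h1
    have h2 : (2 * (Real.pi : ℂ) * Complex.I) ≠ 0 := by simp [Real.pi_ne_zero]
    have h3 : ∮ z in C(c, r), (z - w)⁻¹ • f' u z = (2 * (Real.pi : ℂ) * Complex.I) * f' u w := by
      rw [h1]
      simp only [circleIntegral, hk, smul_eq_mul, mul_assoc]
    rw [h3, smul_eq_mul, inv_mul_cancel_left₀ h2]
  · filter_upwards [closedBall_mem_nhds (0 : 𝕜) hδ] with t ht
    exact (hkc.mul (hfc _ (hδU t ht))).aestronglyMeasurable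
  · apply Continuous.intervalIntegrable
    simp only [zero_smul, add_zero]
    exact hkc.mul (hfc u huU)
  · simp only [zero_smul, add_zero]
    exact (hkc.mul hfc').aestronglyMeasurable
  · refine Eventually.of_forall fun θ _ t ht => ?_
    rw [norm_mul]
    exact mul_le_mul_of_nonneg_left (hM t ht _ (hcirc θ)) (norm_nonneg _)
  · apply Continuous.intervalIntegrable
    fun_prop
  · refine Eventually.of_forall fun θ _ t ht => ?_
    apply HasDerivAt.const_mul
    exact hasDerivAt_line (f := fun v => f v (circleMap c r θ))
      (hu _ (hδU t ht) _ (hsph (hcirc θ)).1 (hsph (hcirc θ)).2)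

end Families

end SpectralCurve

namespace SpectralCurve

/-! ### Simple poles and residues of products -/

open Metric

/-- A local parameter has a simple zero, so dividing by it lowers the order by exactly one. -/
theorem neg_one_le_order_of_mul_analyticAt {g w G : ℂ → ℂ} {c : ℂ} (hw : AnalyticAt ℂ w c)
    (hw0 : w c = 0) (hw' : deriv w c ≠ 0) (hG : AnalyticAt ℂ G c)
    (hg : (fun z => w z * g z) =ᶠ[𝓝[≠] c] G) :
    MeromorphicAt g c ∧ (-1 : WithTop ℤ) ≤ meromorphicOrderAt g c := by
  have h1 : meromorphicOrderAt w c = 1 := by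
    have h2 := hw.analyticOrderAt_sub_eq_one_of_deriv_ne_zero hw'
    simp only [hw0, sub_zero] at h2
    have h3 : analyticOrderAt w c = 1 := h2
    rw [hw.meromorphicOrderAt_eq, h3]
    rfl
  have hne : ∀ᶠ z in 𝓝[≠] c, w z ≠ 0 :=
    (meromorphicOrderAt_ne_top_iff_eventually_ne_zero hw.meromorphicAt).1 (by rw [h1]; exact WithTop.one_ne_top)
  have h4 : g =ᶠ[𝓝[≠] c] w⁻¹ * G := by
    filter_upwards [hg, hne] with z hz hz0
    rw [Pi.mul_apply, Pi.inv_apply, ← hz, inv_mul_cancel_left₀ hz0]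
  refine ⟨(hw.meromorphicAt.inv.mul hG.meromorphicAt).congr (h4.symm), ?_⟩
  rw [meromorphicOrderAt_congr h4, meromorphicOrderAt_mul hw.meromorphicAt.inv hG.meromorphicAt,
    meromorphicOrderAt_inv, h1]
  exact le_add_of_nonneg_right hG.meromorphicOrderAt_nonneg

theorem exists_analyticAt_of_neg_one_le_order {g : ℂ → ℂ} {c : ℂ} (hg : MeromorphicAt g c)
    (h : (-1 : WithTop ℤ) ≤ meromorphicOrderAt g c) :
    ∃ G, AnalyticAt ℂ G c ∧ (fun z => (z - c) * g z) =ᶠ[𝓝[≠] c] G := by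
  have hid : AnalyticAt ℂ (fun z => z - c) c := by fun_prop
  have h1 : meromorphicOrderAt (fun z => z - c) c = 1 := by
    have h3 : analyticOrderAt (fun z => z - c) c = 1 := by
      have := (analyticAt_id (𝕜 := ℂ) (z := c)).analyticOrderAt_sub_eq_one_of_deriv_ne_zero
        (by simp)
      simpa only [id] using this
    rw [hid.meromorphicOrderAt_eq, h3]
    rfl
  have hm : MeromorphicAt (fun z => (z - c) * g z) c := hid.meromorphicAt.mul hg
  refine hm.meromorphicOrderAt_nonneg_iff.1 ?_
  have h2 : meromorphicOrderAt (fun z => (z - c) * g z) c = 1 + meromorphicOrderAt g c := by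
    rw [← h1]
    exact meromorphicOrderAt_mul hid.meromorphicAt hg
  rw [h2]
  calc (0 : WithTop ℤ) = 1 + (-1) := by rfl
    _ ≤ _ := by gcongr

theorem planeResidue_eq_zero_of_order_nonneg {g : ℂ → ℂ} {c : ℂ} (hg : MeromorphicAt g c)
    (h : 0 ≤ meromorphicOrderAt g c) : planeResidue g c = 0 := by
  obtain ⟨G, hG, hGe⟩ := hg.meromorphicOrderAt_nonneg_iff.1 h
  rw [planeResidue_of_simple_pole (h := fun z => (z - c) * G z) (by fun_prop)]
  · simp
  · filter_upwards [hGe, self_mem_nhdsWithin] with z hz hzc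
    rw [hz, inv_mul_cancel_left₀ (sub_ne_zero.2 hzc)]

theorem planeResidue_mul_of_simple_pole {f g : ℂ → ℂ} {c : ℂ} (hf : AnalyticAt ℂ f c)
    (hg : MeromorphicAt g c) (h : (-1 : WithTop ℤ) ≤ meromorphicOrderAt g c) :
    planeResidue (fun z => f z * g z) c = f c * planeResidue g c := by
  obtain ⟨G, hG, hGe⟩ := exists_analyticAt_of_neg_one_le_order hg h
  have h1 : ∀ᶠ z in 𝓝[≠] c, g z = (z - c)⁻¹ * G z := by
    filter_upwards [hGe, self_mem_nhdsWithin] with z hz hzc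
    rw [← hz, inv_mul_cancel_left₀ (sub_ne_zero.2 hzc)]
  rw [planeResidue_of_simple_pole hG h1,
    planeResidue_of_simple_pole (h := fun z => f z * G z) (hf.mul hG)]
  filter_upwards [h1] with z hz
  rw [hz]; ring

/-! ### Joint continuity in the parameter and the point -/

section JointContinuity

variable {𝕜 : Type*} [RCLike 𝕜] [NormedAlgebra 𝕜 ℂ] {E : Type*} [NormedAddCommGroup E]
  [NormedSpace 𝕜 E] [NormedSpace ℝ E] {U : Set E} {Y : Type*} [TopologicalSpace Y] {V : Set Y}

/-- The derivative is locally bounded, so by the mean value inequality `f` is Lipschitz in the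
parameter, uniformly for nearby points `y`; continuity in `y` alone then suffices. -/
theorem continuousOn_of_continuousOn_fderiv (hU : IsOpen U) {f : E → Y → ℂ}
    (hf : ∀ u ∈ U, ContinuousOn (f u) V)
    (hd : ∀ u ∈ U, ∀ y ∈ V, DifferentiableAt 𝕜 (fun v => f v y) u)
    (hc : ContinuousOn (fun q : E × Y => fderiv 𝕜 (fun v => f v q.2) q.1) (U ×ˢ V)) :
    ContinuousOn (fun q : E × Y => f q.1 q.2) (U ×ˢ V) := by
  rintro ⟨u, y⟩ ⟨hu, hy⟩
  set M := ‖fderiv 𝕜 (fun v => f v y) u‖ + 1 with hM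
  have h1 : ∀ᶠ q in 𝓝[U ×ˢ V] (u, y), ‖fderiv 𝕜 (fun v => f v q.2) q.1‖ < M :=
    (hc (u, y) ⟨hu, hy⟩).norm.eventually_lt_const (by simp [hM])
  rw [nhdsWithin_prod_eq, hU.nhdsWithin_eq hu] at h1
  obtain ⟨pa, ha, pb, hb, hab⟩ := Filter.eventually_prod_iff.1 h1
  obtain ⟨δ, hδ, hball⟩ := Metric.eventually_nhds_iff_ball.1 (ha.and (hU.mem_nhds hu))
  have h2 : Tendsto (fun q : E × Y => f q.1 q.2 - f u q.2) (𝓝[U ×ˢ V] (u, y)) (𝓝 0) := by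
    have h3 : Tendsto (fun q : E × Y => M * ‖q.1 - u‖) (𝓝[U ×ˢ V] (u, y)) (𝓝 0) := by
      have : Tendsto (fun q : E × Y => M * ‖q.1 - u‖) (𝓝 (u, y)) (𝓝 (M * ‖u - u‖)) :=
        Continuous.tendsto (by fun_prop) (u, y)
      simp only [sub_self, norm_zero, mul_zero] at this
      exact this.mono_left nhdsWithin_le_nhds
    apply squeeze_zero_norm' _ h3
    have h4 : ∀ᶠ q in 𝓝[U ×ˢ V] (u, y), q.1 ∈ ball u δ ∧ (pb q.2 ∧ q.2 ∈ V) := by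
      rw [nhdsWithin_prod_eq, hU.nhdsWithin_eq hu]
      exact Filter.Eventually.prod_mk (ball_mem_nhds u hδ) (hb.and self_mem_nhdsWithin)
    filter_upwards [h4] with q hq
    exact (convex_ball u δ).norm_image_sub_le_of_norm_fderiv_le (𝕜 := 𝕜)
      (f := fun v => f v q.2) (fun v hv => hd v (hball v hv).2 _ hq.2.2)
      (fun v hv => (hab (hball v hv).1 hq.2.1).le) (mem_ball_self hδ) hq.1
  have h5 : Tendsto (fun q : E × Y => f u q.2) (𝓝[U ×ˢ V] (u, y)) (𝓝 (f u y)) := by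
    have : Tendsto (fun q : E × Y => q.2) (𝓝[U ×ˢ V] (u, y)) (𝓝[V] y) := by
      rw [nhdsWithin_prod_eq]
      exact tendsto_snd
    exact (hf u hu y hy).tendsto.comp this
  have h6 := h2.add h5
  simp only [sub_add_cancel, zero_add] at h6
  exact h6

end JointContinuity

/-! ### Parameter derivatives of Baker–Akhiezer sections -/

section BakerAkhiezer

variable {X : Type*} [TopologicalSpace X] [ChartedSpace ℂ X]

theorem IsLocalParameter.analyticAt [IsManifold 𝓘(ℂ) ω X] {w : X → ℂ} {p : X}
    (hw : IsLocalParameter w p) :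
    AnalyticAt ℂ (w ∘ (chartAt ℂ p).symm) (chartAt ℂ p p) :=
  analyticAt_comp_chart_symm hw.holomorphic

theorem IsLocalParameter.deriv_ne_zero {w : X → ℂ} {p : X} (hw : IsLocalParameter w p) :
    deriv (w ∘ (chartAt ℂ p).symm) (chartAt ℂ p p) ≠ 0 := by
  intro h
  apply hw.mfderiv_ne_zero
  have h1 : MDifferentiableAt 𝓘(ℂ) 𝓘(ℂ) w p := hw.holomorphic.self_of_nhds
  have h2 : fderiv ℂ (w ∘ (chartAt ℂ p).symm) (chartAt ℂ p p) = 0 := by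
    ext
    simpa using h
  have h3 : writtenInExtChartAt 𝓘(ℂ) 𝓘(ℂ) p w = w ∘ (chartAt ℂ p).symm := by
    ext
    simp [writtenInExtChartAt, mfld_simps, chartAt_self_eq]
  have h4 : fderivWithin ℂ (writtenInExtChartAt 𝓘(ℂ) 𝓘(ℂ) p w) (range 𝓘(ℂ))
      (extChartAt 𝓘(ℂ) p p) = (0 : ℂ →L[ℂ] ℂ) := by
    rw [h3]
    simpa [mfld_simps] using h2
  exact h1.mfderiv.trans h4

variable {Γ : NodalCurve X} {𝕜 : Type*} [RCLike 𝕜] [NormedAlgebra 𝕜 ℂ] {n l r : ℕ}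
  {P : Fin n → X} {w : Fin n → X → ℂ} {γ : Fin r → X} {R : Fin l → X} {d : Fin l → ℂ}
  {lam : Fin Γ.numNodes → ℂ} {U : Set (Fin n → 𝕜)} {ψ : (Fin n → 𝕜) → X → ℂ}

/-- The partial derivative of `ψ` as a function on the curve. -/
noncomputable def paramDeriv (ψ : (Fin n → 𝕜) → X → ℂ) (i : Fin n) (u : Fin n → 𝕜) (x : X) : ℂ :=
  partialDeriv i (fun v => ψ v x) u

namespace NodalCurve.IsBakerAkhiezerSection

/-- These zeros will cancel the poles of Ω at R and, after applying σ, at σR. -/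
theorem paramDeriv_normalization (hψ : Γ.IsBakerAkhiezerSection P w γ R d lam U ψ)
    (hU : IsOpen U) {u : Fin n → 𝕜} (hu : u ∈ U) (i : Fin n) (t : Fin l) :
    paramDeriv ψ i u (R t) = 0 := by
  have h : (fun v => ψ v (R t)) =ᶠ[𝓝 u] fun _ => d t := by
    filter_upwards [hU.mem_nhds hu] with v hv
    exact hψ.normalization v hv t
  simp only [paramDeriv, partialDeriv, h.fderiv_eq]
  simp

omit [TopologicalSpace X] [ChartedSpace ℂ X] in
-- The gluing constants do not depend on u, so the derivative inherits both gluing laws.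
theorem paramDeriv_eq_const_mul (hU : IsOpen U) {u : Fin n → 𝕜} (hu : u ∈ U) (i : Fin n)
    {x y : X} {k : ℂ} (hd : DifferentiableAt 𝕜 (fun v => ψ v y) u)
    (h : ∀ v ∈ U, ψ v x = k * ψ v y) : paramDeriv ψ i u x = k * paramDeriv ψ i u y := by
  have h1 : (fun v => ψ v x) =ᶠ[𝓝 u] fun v => k * ψ v y := by
    filter_upwards [hU.mem_nhds hu] with v hv
    exact h v hv
  simp only [paramDeriv, partialDeriv, h1.fderiv_eq, fderiv_const_mul hd]
  simp

theorem exists_punctured_ball [T2Space X] (P : Fin n → X) (γ : Fin r → X) (x : X) :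
    ∃ ρ > 0, ∀ z ∈ ball (chartAt ℂ x x) ρ, z ∈ (chartAt ℂ x).target ∧
      (z ≠ chartAt ℂ x x → (chartAt ℂ x).symm z ∉ range P ∧ (chartAt ℂ x).symm z ∉ range γ) := by
  have h : ∀ᶠ y in 𝓝[≠] x, y ∉ range P ∧ y ∉ range γ := by
    have hf : (range P ∪ range γ).Finite := (finite_range P).union (finite_range γ)
    have h3 : ((range P ∪ range γ) \ {x})ᶜ ∈ 𝓝 x :=
      (hf.subset sdiff_subset).isClosed.isOpen_compl.mem_nhds (by simp)
    rw [eventually_nhdsWithin_iff]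
    filter_upwards [h3] with y hy hyx
    refine ⟨fun hP => hy ⟨Or.inl hP, hyx⟩, fun hγ => hy ⟨Or.inr hγ, hyx⟩⟩
  have h1 := eventually_nhdsWithin_iff.1 (eventually_nhdsNE_chart_symm h)
  exact Metric.eventually_nhds_iff_ball.1
    (((chartAt ℂ x).open_target.eventually_mem (mem_chart_target ℂ x)).and h1)

variable [IsManifold 𝓘(ℂ) ω X]

/-- Multiplying the family by a factor which makes all its members holomorphic also makes the
derivative in the parameters holomorphic. -/
theorem exists_analyticAt_fderiv_mul (hψ : Γ.IsBakerAkhiezerSection P w γ R d lam U ψ)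
    (hU : IsOpen U) {u : Fin n → 𝕜} (hu : u ∈ U) (i : Fin n) {x : X} {ρ : ℝ} (hρ : 0 < ρ)
    (hball : ∀ z ∈ ball (chartAt ℂ x x) ρ, z ∈ (chartAt ℂ x).target ∧
      (z ≠ chartAt ℂ x x → (chartAt ℂ x).symm z ∉ range P ∧ (chartAt ℂ x).symm z ∉ range γ))
    {m : (Fin n → 𝕜) → ℂ → ℂ} {m' : (Fin n → 𝕜) → ℂ → ℂ}
    (hm : ∀ v ∈ U, ∀ z ∈ ball (chartAt ℂ x x) ρ, z ≠ chartAt ℂ x x → DifferentiableAt ℂ (m v) z)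
    (hmu : ∀ v ∈ U, ∀ z ∈ ball (chartAt ℂ x x) ρ, z ≠ chartAt ℂ x x →
      ∃ L : (Fin n → 𝕜) →L[𝕜] ℂ, HasFDerivAt (fun v => m v z) L v ∧ L (Pi.single i 1) = m' v z)
    (hmc : ContinuousOn (fun q : (Fin n → 𝕜) × ℂ => m q.1 q.2)
      (U ×ˢ (ball (chartAt ℂ x x) ρ \ {chartAt ℂ x x})))
    (hmc' : ContinuousOn (fun q : (Fin n → 𝕜) × ℂ => m' q.1 q.2)
      (U ×ˢ (ball (chartAt ℂ x x) ρ \ {chartAt ℂ x x})))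
    (hF : ∀ v ∈ U, ∃ F, AnalyticAt ℂ F (chartAt ℂ x x) ∧
      (fun z => m v z * ψ v ((chartAt ℂ x).symm z)) =ᶠ[𝓝[≠] (chartAt ℂ x x)] F) :
    ∃ G, AnalyticAt ℂ G (chartAt ℂ x x) ∧
      (fun z => m u z * paramDeriv ψ i u ((chartAt ℂ x).symm z) +
        m' u z * ψ u ((chartAt ℂ x).symm z)) =ᶠ[𝓝[≠] (chartAt ℂ x x)] G := by
  set e := chartAt ℂ x with he
  set c := e x with hc
  have hdψ : ∀ v ∈ U, ∀ z ∈ ball c ρ, z ≠ c → DifferentiableAt ℂ (fun z => ψ v (e.symm z)) z :=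
    fun v hv z hz hzc => differentiableAt_comp_chart_symm (hball z hz).1
      (hψ.holomorphic v hv _ ((hball z hz).2 hzc).1 ((hball z hz).2 hzc).2)
  have huψ : ∀ v ∈ U, ∀ z ∈ ball c ρ, z ≠ c →
      DifferentiableAt 𝕜 (fun v => ψ v (e.symm z)) v := fun v hv z hz hzc =>
    hψ.differentiable v hv _ ((hball z hz).2 hzc).1 ((hball z hz).2 hzc).2
  have hcψ : ContinuousOn
      (fun q : (Fin n → 𝕜) × ℂ => fderiv 𝕜 (fun v => ψ v (e.symm q.2)) q.1)
      (U ×ˢ (ball c ρ \ {c})) := by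
    refine hψ.continuous_fderiv.comp (f := fun q : (Fin n → 𝕜) × ℂ => (q.1, e.symm q.2)) ?_ ?_
    · refine continuousOn_fst.prodMk (e.continuousOn_symm.comp continuousOn_snd ?_)
      exact fun q hq => (hball q.2 hq.2.1).1
    · rintro q ⟨hq1, hq2⟩
      refine ⟨hq1, ?_⟩
      rintro (h | h)
      · exact ((hball q.2 hq2.1).2 hq2.2).1 h
      · exact ((hball q.2 hq2.1).2 hq2.2).2 h
  have hjψ : ContinuousOn (fun q : (Fin n → 𝕜) × ℂ => ψ q.1 (e.symm q.2))
      (U ×ˢ (ball c ρ \ {c})) :=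
    continuousOn_of_continuousOn_fderiv (𝕜 := 𝕜) hU (f := fun v z => ψ v (e.symm z))
      (fun v hv z hz => (hdψ v hv z hz.1 hz.2).continuousAt.continuousWithinAt)
      (fun v hv z hz => huψ v hv z hz.1 hz.2) hcψ
  have hprod : ∀ v ∈ U, ∀ z ∈ ball c ρ, z ≠ c →
      DifferentiableAt 𝕜 (fun v => m v z * ψ v (e.symm z)) v ∧
      fderiv 𝕜 (fun v => m v z * ψ v (e.symm z)) v (Pi.single i 1) =
        m v z * paramDeriv ψ i v (e.symm z) + m' v z * ψ v (e.symm z) := by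
    intro v hv z hz hzc
    obtain ⟨L, hL, hL'⟩ := hmu v hv z hz hzc
    have h1 := hL.mul (huψ v hv z hz hzc).hasFDerivAt
    refine ⟨h1.differentiableAt, ?_⟩
    have h2 : fderiv 𝕜 (fun v => m v z * ψ v (e.symm z)) v = _ := h1.fderiv
    rw [h2]
    simp only [add_apply, smul_apply, smul_eq_mul, hL', paramDeriv, partialDeriv]
    ring
  have hcont : ContinuousOn (fun q : (Fin n → 𝕜) × ℂ =>
      fderiv 𝕜 (fun v => m v q.2 * ψ v (e.symm q.2)) q.1 (Pi.single i 1))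
      (U ×ˢ (ball c ρ \ {c})) := by
    refine ContinuousOn.congr ((hmc.mul (hcψ.clm_apply
      (continuousOn_const (c := (Pi.single i 1 : Fin n → 𝕜))))).add (hmc'.mul hjψ)) ?_
    rintro q ⟨hq1, hq2⟩
    exact (hprod q.1 hq1 q.2 hq2.1 hq2.2).2
  obtain ⟨G, hG, hGe⟩ := exists_analyticAt_fderiv_of_family (𝕜 := 𝕜) hU hρ
    (f := fun v z => m v z * ψ v (e.symm z)) (Pi.single i 1) (c := c)
    (fun v hv z hz hzc => (hm v hv z hz hzc).mul (hdψ v hv z hz hzc)) hF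
    (fun v hv z hz hzc => (hprod v hv z hz hzc).1) hcont hu
  refine ⟨G, hG, ?_⟩
  rw [EventuallyEq, eventually_nhdsWithin_iff] at hGe ⊢
  filter_upwards [hGe, ball_mem_nhds c hρ] with z hz hzb hzc
  rw [← hz hzc, (hprod u hu z hzb hzc).2]

end NodalCurve.IsBakerAkhiezerSection

end BakerAkhiezer

end SpectralCurve

namespace SpectralCurve

open Metric

/-! ### Singularities of the parameter derivatives -/

section LocalBehaviour

variable {X : Type*} [TopologicalSpace X] [ChartedSpace ℂ X] [IsManifold 𝓘(ℂ) ω X] [T2Space X]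
  {Γ : NodalCurve X} {𝕜 : Type*} [RCLike 𝕜] [NormedAlgebra 𝕜 ℂ] {n l r : ℕ}
  {P : Fin n → X} {w : Fin n → X → ℂ} {γ : Fin r → X} {R : Fin l → X} {d : Fin l → ℂ}
  {lam : Fin Γ.numNodes → ℂ} {U : Set (Fin n → 𝕜)} {ψ : (Fin n → 𝕜) → X → ℂ}

namespace NodalCurve.IsBakerAkhiezerSection

theorem analyticAt_paramDeriv (hψ : Γ.IsBakerAkhiezerSection P w γ R d lam U ψ)
    (hU : IsOpen U) {u : Fin n → 𝕜} (hu : u ∈ U) (i : Fin n) {x : X} (hP : x ∉ range P)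
    (hγ : x ∉ range γ) :
    AnalyticAt ℂ (paramDeriv ψ i u ∘ (chartAt ℂ x).symm) (chartAt ℂ x x) := by
  obtain ⟨ρ, hρ, hball⟩ := exists_punctured_ball P γ x
  have hx := (chartAt ℂ x).left_inv (mem_chart_source ℂ x)
  have hV : IsOpen ((range P ∪ range γ)ᶜ) :=
    ((finite_range P).union (finite_range γ)).isClosed.isOpen_compl
  have hxV : x ∈ (range P ∪ range γ)ᶜ := fun h => h.elim hP hγ
  have hF : ∀ v ∈ U, AnalyticAt ℂ (ψ v ∘ (chartAt ℂ x).symm) (chartAt ℂ x x) := by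
    intro v hv
    apply analyticAt_comp_chart_symm
    filter_upwards [hV.mem_nhds hxV] with y hy
    exact hψ.holomorphic v hv y (fun h => hy (Or.inl h)) (fun h => hy (Or.inr h))
  obtain ⟨G, hG, hGe⟩ := hψ.exists_analyticAt_fderiv_mul hU hu i hρ hball (m := fun _ _ => 1)
    (m' := fun _ _ => 0) (fun v _ z _ _ => by fun_prop)
    (fun v _ z _ _ => ⟨0, hasFDerivAt_const _ _, by simp⟩) continuousOn_const continuousOn_const
    (fun v hv => ⟨_, hF v hv, by simp only [one_mul]; exact EventuallyEq.rfl⟩)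
  -- The family argument identifies the derivative with an analytic function only off `x`;
  -- continuity settles the value at `x`.
  have hc : ContinuousAt (paramDeriv ψ i u) x := by
    have h1 : ContinuousOn (fun y => fderiv 𝕜 (fun v => ψ v y) u (Pi.single i 1))
        ((range P ∪ range γ)ᶜ) :=
      (hψ.continuous_fderiv.comp (f := fun y => (u, y)) (by fun_prop)
        (fun y hy => ⟨hu, hy⟩)).clm_apply continuousOn_const
    exact h1.continuousAt (hV.mem_nhds hxV)
  have hc' : ContinuousAt (paramDeriv ψ i u ∘ (chartAt ℂ x).symm) (chartAt ℂ x x) := by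
    apply ContinuousAt.comp _ ((chartAt ℂ x).continuousAt_symm (mem_chart_target ℂ x))
    rwa [hx]
  refine (hG.meromorphicAt.congr ?_).analyticAt hc'
  filter_upwards [hGe] with z hz
  rw [← hz]; simp

theorem neg_one_le_order_paramDeriv (hψ : Γ.IsBakerAkhiezerSection P w γ R d lam U ψ)
    (hU : IsOpen U) {u : Fin n → 𝕜} (hu : u ∈ U) (i : Fin n) (s : Fin r) :
    IsMeromorphicAt (paramDeriv ψ i u) (γ s) ∧
      (-1 : WithTop ℤ) ≤ order (paramDeriv ψ i u) (γ s) := by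
  obtain ⟨ρ, hρ, hball⟩ := exists_punctured_ball P γ (γ s)
  obtain ⟨G, hG, hGe⟩ := hψ.exists_analyticAt_fderiv_mul hU hu i hρ hball
    (m := fun _ z => z - chartAt ℂ (γ s) (γ s))
    (m' := fun _ _ => 0) (fun v _ z _ _ => by fun_prop)
    (fun v _ z _ _ => ⟨0, hasFDerivAt_const _ _, by simp⟩) (by fun_prop) continuousOn_const
    (fun v hv => exists_analyticAt_of_neg_one_le_order (hψ.pole v hv s).1 (hψ.pole v hv s).2)
  refine neg_one_le_order_of_mul_analyticAt (w := fun z => z - chartAt ℂ (γ s) (γ s))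
    (by fun_prop) (by simp) (by simp) hG ?_
  filter_upwards [hGe] with z hz
  rw [← hz]; simp

/-- The derivative of `ψ` in the `i`-th parameter near `P k`, after division by the
exponential factor. -/
theorem order_exp_mul_paramDeriv (hψ : Γ.IsBakerAkhiezerSection P w γ R d lam U ψ)
    (hU : IsOpen U) {u : Fin n → 𝕜} (hu : u ∈ U) (i k : Fin n)
    (hw : IsLocalParameter (w k) (P k)) :
    let H : X → ℂ := fun x => Complex.exp (-((w k x)⁻¹ * algebraMap 𝕜 ℂ (u k))) * paramDeriv ψ i u x
    IsMeromorphicAt H (P k) ∧ (if i = k then (-1 : WithTop ℤ) else 0) ≤ order H (P k) := by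
  intro H
  set e := chartAt ℂ (P k) with he
  set c := e (P k) with hc
  set W : ℂ → ℂ := w k ∘ e.symm with hW
  have hWa : AnalyticAt ℂ W c := hw.analyticAt
  have hW0 : W c = 0 := by
    simp only [hW, hc, Function.comp_apply, he,
      (chartAt ℂ (P k)).left_inv (mem_chart_source ℂ (P k)), hw.map_eq_zero]
  have hW' : deriv W c ≠ 0 := hw.deriv_ne_zero
  have hWne : ∀ᶠ z in 𝓝[≠] c, W z ≠ 0 := by
    have := hWa.differentiableAt.hasDerivAt.eventually_ne (c := 0) hW'
    exact this
  obtain ⟨ρ₀, hρ₀, hball₀⟩ := exists_punctured_ball P γ (P k)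
  obtain ⟨ρ₁, hρ₁, hball₁⟩ := Metric.eventually_nhds_iff_ball.1
    (hWa.eventually_analyticAt.and (eventually_nhdsWithin_iff.1 hWne))
  set ρ := min ρ₀ ρ₁ with hρ
  have hρpos : 0 < ρ := lt_min hρ₀ hρ₁
  have hball : ∀ z ∈ ball c ρ, z ∈ e.target ∧
      (z ≠ c → e.symm z ∉ range P ∧ e.symm z ∉ range γ) := fun z hz =>
    hball₀ z (ball_subset_ball (min_le_left _ _) hz)
  have hWan : ∀ z ∈ ball c ρ, AnalyticAt ℂ W z := fun z hz =>
    (hball₁ z (ball_subset_ball (min_le_right _ _) hz)).1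
  have hWnz : ∀ z ∈ ball c ρ, z ≠ c → W z ≠ 0 := fun z hz =>
    (hball₁ z (ball_subset_ball (min_le_right _ _) hz)).2
  set a := algebraMap 𝕜 ℂ with ha
  have hac : Continuous a := (algebraMapCLM 𝕜 ℂ).continuous
  -- The inverse of the exponential factor. It depends on the parameters through `v k` alone, so its
  -- derivative `m'` vanishes unless `i = k`.
  set m : (Fin n → 𝕜) → ℂ → ℂ := fun v z => Complex.exp (-((W z)⁻¹ * a (v k))) with hm
  set m' : (Fin n → 𝕜) → ℂ → ℂ := fun v z =>
    m v z * (-((W z)⁻¹ * a ((Pi.single i 1 : Fin n → 𝕜) k))) with hm'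
  have hWinv : ContinuousOn (fun q : (Fin n → 𝕜) × ℂ => (W q.2)⁻¹) (U ×ˢ (ball c ρ \ {c})) := by
    apply ContinuousOn.inv₀
    · refine ContinuousOn.comp (g := W) (t := ball c ρ) (fun z hz =>
        (hWan z hz).continuousAt.continuousWithinAt) continuousOn_snd fun q hq => hq.2.1
    · exact fun q hq => hWnz _ hq.2.1 hq.2.2
  have hmc : ContinuousOn (fun q : (Fin n → 𝕜) × ℂ => m q.1 q.2) (U ×ˢ (ball c ρ \ {c})) := by
    apply ContinuousOn.cexp
    exact (hWinv.mul (by fun_prop)).neg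
  have hF : ∀ v ∈ U, ∃ F, AnalyticAt ℂ F c ∧ (fun z => m v z * ψ v (e.symm z)) =ᶠ[𝓝[≠] c] F := by
    intro v hv
    obtain ⟨F, hF1, hF2⟩ := hψ.essential v hv k
    refine ⟨F ∘ e.symm, analyticAt_comp_chart_symm hF1, ?_⟩
    filter_upwards [eventually_nhdsNE_chart_symm hF2] with z hz
    simp only [hm, hW, Function.comp_apply, he, ha, hz]
    rw [← mul_assoc, ← Complex.exp_add, neg_add_cancel, Complex.exp_zero, one_mul]
  have hmd : ∀ v ∈ U, ∀ z ∈ ball c ρ, z ≠ c → DifferentiableAt ℂ (m v) z := by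
    intro v _ z hz hzc
    have := (hWan z hz).differentiableAt.inv (hWnz z hz hzc)
    exact ((this.mul_const _).neg).cexp
  have hmu : ∀ v ∈ U, ∀ z ∈ ball c ρ, z ≠ c → ∃ L : (Fin n → 𝕜) →L[𝕜] ℂ,
      HasFDerivAt (fun v => m v z) L v ∧ L (Pi.single i 1) = m' v z := by
    intro v _ z hz hzc
    have h1 : HasFDerivAt (fun v : Fin n → 𝕜 => a (v k))
        ((algebraMapCLM 𝕜 ℂ).comp (ContinuousLinearMap.proj (R := 𝕜) (φ := fun _ : Fin n => 𝕜) k)) v :=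
      ((algebraMapCLM 𝕜 ℂ).comp
        (ContinuousLinearMap.proj (R := 𝕜) (φ := fun _ : Fin n => 𝕜) k)).hasFDerivAt
    refine ⟨_, ((h1.const_mul ((W z)⁻¹)).neg).cexp, ?_⟩
    simp [hm', hm, ha]
  have hmc' : ContinuousOn (fun q : (Fin n → 𝕜) × ℂ => m' q.1 q.2) (U ×ˢ (ball c ρ \ {c})) :=
    hmc.mul (hWinv.mul continuousOn_const).neg
  obtain ⟨G, hG, hGe⟩ := hψ.exists_analyticAt_fderiv_mul hU hu i hρpos hball hmd hmu hmc hmc' hF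
  obtain ⟨F, hFa, hFe⟩ := hF u hu
  by_cases hik : i = k
  · rw [if_pos hik]
    -- With F = mψ one has G = m ∂ψ - W⁻¹F, hence W · m ∂ψ = WG + F is analytic.
    refine neg_one_le_order_of_mul_analyticAt hWa hW0 hW'
      (G := fun z => W z * G z + F z) ((hWa.mul hG).add hFa) ?_
    filter_upwards [hGe, hFe, hWne] with z hz hz2 hz3
    have h1 : (Pi.single i 1 : Fin n → 𝕜) k = 1 := by rw [hik, Pi.single_eq_same]
    rw [← hz, ← hz2]
    simp only [hm', h1, map_one, mul_one]
    change W z * (m u z * paramDeriv ψ i u (e.symm z)) = _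
    field_simp
    ring
  · rw [if_neg hik]
    have h1 : (Pi.single i 1 : Fin n → 𝕜) k = 0 := Pi.single_eq_of_ne (Ne.symm hik) _
    have h2 : H ∘ e.symm =ᶠ[𝓝[≠] c] G := by
      filter_upwards [hGe] with z hz
      rw [← hz]
      simp only [hm', h1, map_zero, mul_zero, neg_zero, zero_mul, add_zero]
      rfl
    refine ⟨hG.meromorphicAt.congr h2.symm, ?_⟩
    rw [order, meromorphicOrderAt_congr h2]
    exact hG.meromorphicOrderAt_nonneg

end NodalCurve.IsBakerAkhiezerSection

end LocalBehaviour

/-! ### Pullback by the involution -/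

section Involution

variable {X : Type*} [TopologicalSpace X] [ChartedSpace ℂ X] [IsManifold 𝓘(ℂ) ω X]

/-- A holomorphic involution, read in charts, is a local biholomorphism. -/
theorem exists_analyticAt_lift_involution {σ : X → X}
    (hσ : MDifferentiable 𝓘(ℂ) 𝓘(ℂ) σ) (hinv : Function.Involutive σ) (x : X) :
    ∃ T : ℂ → ℂ, AnalyticAt ℂ T (chartAt ℂ x x) ∧ deriv T (chartAt ℂ x x) ≠ 0 ∧
      T (chartAt ℂ x x) = chartAt ℂ (σ x) (σ x) ∧
      ∀ f : X → ℂ, (f ∘ σ) ∘ (chartAt ℂ x).symm =ᶠ[𝓝 (chartAt ℂ x x)]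
        (f ∘ (chartAt ℂ (σ x)).symm) ∘ T := by
  have htrans : ∀ x : X, AnalyticAt ℂ (chartAt ℂ (σ x) ∘ σ ∘ (chartAt ℂ x).symm) (chartAt ℂ x x) := by
    intro x
    have hS : ∀ᶠ y in 𝓝 x, σ y ∈ (chartAt ℂ (σ x)).source :=
      (hσ x).continuousAt.eventually_mem
        ((chartAt ℂ (σ x)).open_source.mem_nhds (mem_chart_source ℂ _))
    refine analyticAt_comp_chart_symm (f := chartAt ℂ (σ x) ∘ σ) ?_
    filter_upwards [hS] with y hy
    exact (mdifferentiableAt_atlas (chart_mem_atlas ℂ _) hy).comp y (hσ y)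
  have hsymm : ∀ {y : X}, (chartAt ℂ y).symm (chartAt ℂ y y) = y := fun {y} =>
    (chartAt ℂ y).left_inv (mem_chart_source ℂ y)
  set T := chartAt ℂ (σ x) ∘ σ ∘ (chartAt ℂ x).symm with hT
  have hTa : AnalyticAt ℂ T (chartAt ℂ x x) := htrans x
  have hTc : T (chartAt ℂ x x) = chartAt ℂ (σ x) (σ x) := by
    simp only [hT, Function.comp_apply, hsymm]
  have hnear : ∀ᶠ z in 𝓝 (chartAt ℂ x x), z ∈ (chartAt ℂ x).target ∧
      (chartAt ℂ (σ x)).symm (T z) = σ ((chartAt ℂ x).symm z) := by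
    have hS : ∀ᶠ y in 𝓝 ((chartAt ℂ x).symm (chartAt ℂ x x)), σ y ∈ (chartAt ℂ (σ x)).source := by
      rw [hsymm]
      exact (hσ x).continuousAt.eventually_mem
        ((chartAt ℂ (σ x)).open_source.mem_nhds (mem_chart_source ℂ _))
    filter_upwards [eventually_nhds_chart_symm (mem_chart_target ℂ x) hS,
      (chartAt ℂ x).open_target.mem_nhds (mem_chart_target ℂ x)] with z hz hzt
    exact ⟨hzt, (chartAt ℂ (σ x)).left_inv hz⟩
  -- σ read in charts at `x` and at `σ x` gives mutually inverse germs, so the product of their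
  -- derivatives is 1.
  have hder : deriv T (chartAt ℂ x x) ≠ 0 := by
    intro h0
    have h1 := htrans (σ x)
    rw [hinv x] at h1
    set T' := chartAt ℂ x ∘ σ ∘ (chartAt ℂ (σ x)).symm with hT'
    have h2 : T' ∘ T =ᶠ[𝓝 (chartAt ℂ x x)] id := by
      filter_upwards [hnear] with z hz
      simp only [hT', Function.comp_apply, id]
      rw [hz.2, hinv, (chartAt ℂ x).right_inv hz.1]
    have h3 := h2.deriv_eq
    rw [deriv_comp _ (by rw [hTc]; exact h1.differentiableAt) hTa.differentiableAt, h0,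
      mul_zero, deriv_id] at h3
    exact zero_ne_one h3
  refine ⟨T, hTa, hder, hTc, fun f => ?_⟩
  filter_upwards [hnear] with z hz
  simp only [Function.comp_apply (f := f), Function.comp_apply (f := f ∘ (chartAt ℂ (σ x)).symm),
    hz.2, Function.comp_apply]

theorem isMeromorphicAt_and_order_comp_involution {σ : X → X}
    (hσ : MDifferentiable 𝓘(ℂ) 𝓘(ℂ) σ) (hinv : Function.Involutive σ) {f : X → ℂ} {x : X}
    (hf : IsMeromorphicAt f (σ x)) :
    IsMeromorphicAt (f ∘ σ) x ∧ order (f ∘ σ) x = order f (σ x) := by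
  obtain ⟨T, hTa, hder, hTc, hcomp⟩ := exists_analyticAt_lift_involution hσ hinv x
  constructor
  · have h1 : MeromorphicAt ((f ∘ (chartAt ℂ (σ x)).symm) ∘ T) (chartAt ℂ x x) :=
      MeromorphicAt.comp_analyticAt (by rw [hTc]; exact hf) hTa
    exact h1.congr ((hcomp f).symm.filter_mono nhdsWithin_le_nhds)
  · rw [order, meromorphicOrderAt_congr ((hcomp f).filter_mono nhdsWithin_le_nhds),
      meromorphicOrderAt_comp_of_deriv_ne_zero hTa hder, hTc]
    rfl

theorem analyticAt_comp_involution {σ : X → X}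
    (hσ : MDifferentiable 𝓘(ℂ) 𝓘(ℂ) σ) (hinv : Function.Involutive σ) {f : X → ℂ} {x : X}
    (hf : AnalyticAt ℂ (f ∘ (chartAt ℂ (σ x)).symm) (chartAt ℂ (σ x) (σ x))) :
    AnalyticAt ℂ ((f ∘ σ) ∘ (chartAt ℂ x).symm) (chartAt ℂ x x) := by
  obtain ⟨T, hTa, -, hTc, hcomp⟩ := exists_analyticAt_lift_involution hσ hinv x
  exact (AnalyticAt.comp (by rwa [hTc]) hTa).congr (hcomp f).symm

end Involution

end SpectralCurve

namespace SpectralCurve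

/-! ### Multiplicities in divisors -/

section Divisors

variable {X : Type*}

theorem divisor_apply_of_mem [TopologicalSpace X] [ChartedSpace ℂ X] {k : ℕ} {D : Fin k → X}
    (hD : Function.Injective D) {x : X} (hx : x ∈ range D) : divisor D x = 1 := by
  classical
  obtain ⟨i, rfl⟩ := hx
  rw [divisor, Finsupp.finsetSum_apply, Finset.sum_eq_single i]
  · simp
  · intro j _ hj
    exact Finsupp.single_eq_of_ne (fun h => hj (hD h).symm)
  · simp

theorem divisor_apply_of_notMem [TopologicalSpace X] [ChartedSpace ℂ X] {k : ℕ} {D : Fin k → X}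
    {x : X} (hx : x ∉ range D) : divisor D x = 0 := by
  classical
  rw [divisor, Finsupp.finsetSum_apply, Finset.sum_eq_zero]
  intro j _
  exact Finsupp.single_eq_of_ne (fun h => hx ⟨j, h.symm⟩)

theorem divisor_comp_involution [TopologicalSpace X] [ChartedSpace ℂ X] {k : ℕ} {D : Fin k → X}
    (hD : Function.Injective D) {σ : X → X} (hσ : Function.Involutive σ) (x : X) :
    divisor (σ ∘ D) x = divisor D (σ x) := by
  by_cases hx : σ x ∈ range D
  · rw [divisor_apply_of_mem hD hx, divisor_apply_of_mem (hσ.injective.comp hD)]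
    obtain ⟨i, hi⟩ := hx
    exact ⟨i, by rw [Function.comp_apply, hi, hσ]⟩
  · rw [divisor_apply_of_notMem hx, divisor_apply_of_notMem]
    rintro ⟨i, rfl⟩
    exact hx ⟨i, by rw [Function.comp_apply, hσ]⟩

theorem divisor_nonneg [TopologicalSpace X] [ChartedSpace ℂ X] {k : ℕ} (D : Fin k → X) (x : X) :
    0 ≤ divisor D x := by
  classical
  rw [divisor, Finsupp.finsetSum_apply]
  refine Finset.sum_nonneg fun i _ => ?_
  rw [Finsupp.single_apply]
  split_ifs <;> simp

end Divisors

/-! ### Products of functions and 1-forms -/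

section OneForms

variable {X : Type*} [TopologicalSpace X] [ChartedSpace ℂ X]

/-- The product of a function and a form. -/
noncomputable def OneForm.mulFun (f : X → ℂ) (η : OneForm X) : OneForm X := fun x => f x • η x

theorem OneForm.coeff_mulFun (f : X → ℂ) (η : OneForm X) (x : X) :
    (η.mulFun f).coeff x = fun z => (f ∘ (chartAt ℂ x).symm) z * η.coeff x z := rfl

theorem OneForm.residue_mulFun {f : X → ℂ} {η : OneForm X} {x : X}
    (hf : AnalyticAt ℂ (f ∘ (chartAt ℂ x).symm) (chartAt ℂ x x)) (hη : η.IsMeromorphic)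
    (h : (-1 : WithTop ℤ) ≤ η.order x) : (η.mulFun f).residue x = f x * η.residue x := by
  rw [OneForm.residue, OneForm.coeff_mulFun, planeResidue_mul_of_simple_pole hf (hη x) h,
    Function.comp_apply, (chartAt ℂ x).left_inv (mem_chart_source ℂ x)]
  rfl

theorem OneForm.order_mulFun {f : X → ℂ} {η : OneForm X} {x : X} (hf : IsMeromorphicAt f x)
    (hη : η.IsMeromorphic) :
    MeromorphicAt ((η.mulFun f).coeff x) (chartAt ℂ x x) ∧
      (η.mulFun f).order x = SpectralCurve.order f x + η.order x :=
  ⟨hf.mul (hη x), meromorphicOrderAt_mul hf (hη x)⟩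

theorem isMeromorphicAt_mul {f g : X → ℂ} {x : X} (hf : IsMeromorphicAt f x)
    (hg : IsMeromorphicAt g x) : IsMeromorphicAt (fun y => f y * g y) x ∧
      SpectralCurve.order (fun y => f y * g y) x =
        SpectralCurve.order f x + SpectralCurve.order g x :=
  ⟨hf.mul hg, meromorphicOrderAt_mul hf hg⟩

theorem isMeromorphicAt_congr {f g : X → ℂ} {x : X} (hf : IsMeromorphicAt f x)
    (hfg : f =ᶠ[𝓝[≠] x] g) : IsMeromorphicAt g x ∧
      SpectralCurve.order g x = SpectralCurve.order f x := by
  have h := eventually_nhdsNE_chart_symm hfg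
  exact ⟨hf.congr h, (meromorphicOrderAt_congr h).symm⟩

end OneForms

/-! ### Orders of the derivatives and cancellation of the exponentials -/

section BakerAkhiezerOrders

variable {X : Type*} [TopologicalSpace X] [ChartedSpace ℂ X] [IsManifold 𝓘(ℂ) ω X] [T2Space X]
  {Γ : NodalCurve X} {𝕜 : Type*} [RCLike 𝕜] [NormedAlgebra 𝕜 ℂ] {n l r : ℕ}
  {P : Fin n → X} {w : Fin n → X → ℂ} {γ : Fin r → X} {R : Fin l → X} {d : Fin l → ℂ}
  {lam : Fin Γ.numNodes → ℂ} {U : Set (Fin n → 𝕜)} {ψ : (Fin n → 𝕜) → X → ℂ}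

theorem one_le_order_of_analyticAt {f : ℂ → ℂ} {c : ℂ} (hf : AnalyticAt ℂ f c) (h0 : f c = 0) :
    (1 : WithTop ℤ) ≤ meromorphicOrderAt f c := by
  have h1 : 0 < meromorphicOrderAt f c := by
    rw [← tendsto_zero_iff_meromorphicOrderAt_pos hf.meromorphicAt, ← h0]
    exact hf.continuousAt.tendsto.mono_left nhdsWithin_le_nhds
  cases h : meromorphicOrderAt f c with
  | top => exact le_top
  | coe m =>
    rw [h] at h1
    have h2 : 0 < m := by exact_mod_cast h1
    exact_mod_cast h2

/-- Off `P`, the divisor of `∂ψ/∂uⁱ` is at least `R - γ`. -/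
theorem NodalCurve.IsBakerAkhiezerSection.le_order_paramDeriv
    (hψ : Γ.IsBakerAkhiezerSection P w γ R d lam U ψ)
    (hU : IsOpen U) (hγ : Function.Injective γ) (hR : Function.Injective R)
    (hγR : Disjoint (range γ) (range R)) {u : Fin n → 𝕜} (hu : u ∈ U) (i : Fin n)
    {x : X} (hx : x ∉ range P) :
    IsMeromorphicAt (paramDeriv ψ i u) x ∧
      ((divisor R x - divisor γ x : ℤ) : WithTop ℤ) ≤ order (paramDeriv ψ i u) x := by
  by_cases hxγ : x ∈ range γ
  · rw [divisor_apply_of_mem hγ hxγ, divisor_apply_of_notMem (hγR.notMem_of_mem_left hxγ)]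
    obtain ⟨s, rfl⟩ := hxγ
    exact hψ.neg_one_le_order_paramDeriv hU hu i s
  · have hA := hψ.analyticAt_paramDeriv hU hu i hx hxγ
    refine ⟨hA.meromorphicAt, ?_⟩
    rw [divisor_apply_of_notMem hxγ]
    by_cases hxR : x ∈ range R
    · rw [divisor_apply_of_mem hR hxR]
      apply one_le_order_of_analyticAt hA
      rw [Function.comp_apply, (chartAt ℂ x).left_inv (mem_chart_source ℂ x)]
      obtain ⟨t, rfl⟩ := hxR
      exact hψ.paramDeriv_normalization hU hu i t
    · rw [divisor_apply_of_notMem hxR]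
      exact hA.meromorphicOrderAt_nonneg

/-- At `P k` the exponential factors of `∂ψ/∂uⁱ` and `σ^*(∂ψ/∂uʲ)` cancel. -/
theorem NodalCurve.IsBakerAkhiezerSection.neg_one_le_order_mul_involution
    (hψ : Γ.IsBakerAkhiezerSection P w γ R d lam U ψ)
    (hU : IsOpen U) {u : Fin n → 𝕜} (hu : u ∈ U) {i j : Fin n} (hij : i ≠ j) (k : Fin n)
    (hw : IsLocalParameter (w k) (P k)) {σ : X → X} (hσ : Γ.IsHolomorphicInvolution σ)
    (hσP : σ (P k) = P k) (hσw : ∀ᶠ x in 𝓝 (P k), w k (σ x) = -w k x) :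
    IsMeromorphicAt (fun x => paramDeriv ψ i u x * paramDeriv ψ j u (σ x)) (P k) ∧
      (-1 : WithTop ℤ) ≤ order (fun x => paramDeriv ψ i u x * paramDeriv ψ j u (σ x)) (P k) := by
  obtain ⟨hi1, hi2⟩ := hψ.order_exp_mul_paramDeriv hU hu i k hw
  obtain ⟨hj1, hj2⟩ := hψ.order_exp_mul_paramDeriv hU hu j k hw
  set Hi : X → ℂ := fun x =>
    Complex.exp (-((w k x)⁻¹ * algebraMap 𝕜 ℂ (u k))) * paramDeriv ψ i u x with hHi
  set Hj : X → ℂ := fun x =>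
    Complex.exp (-((w k x)⁻¹ * algebraMap 𝕜 ℂ (u k))) * paramDeriv ψ j u x with hHj
  obtain ⟨hj3, hj4⟩ := isMeromorphicAt_and_order_comp_involution hσ.holomorphic hσ.involutive
    (f := Hj) (x := P k) (by rwa [hσP])
  obtain ⟨hm, ho⟩ := isMeromorphicAt_mul hi1 hj3
  have hcongr : (fun y => Hi y * (Hj ∘ σ) y) =ᶠ[𝓝[≠] (P k)]
      fun x => paramDeriv ψ i u x * paramDeriv ψ j u (σ x) := by
    filter_upwards [hσw.filter_mono nhdsWithin_le_nhds] with x hx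
    simp only [hHi, hHj, Function.comp_apply, hx]
    rw [mul_mul_mul_comm, ← Complex.exp_add, inv_neg, neg_mul, neg_neg, neg_add_cancel,
      Complex.exp_zero, one_mul]
  obtain ⟨hm', ho'⟩ := isMeromorphicAt_congr hm hcongr
  refine ⟨hm', ?_⟩
  rw [ho', ho, hj4, hσP]
  refine le_trans ?_ (add_le_add hi2 hj2)
  -- Since `i ≠ j`, at most one of the two factors has lower bound -1.
  by_cases hik : i = k
  · have hjk : j ≠ k := fun h => hij (hik.trans h.symm)
    rw [if_pos hik, if_neg hjk, add_zero]
  · rw [if_neg hik, zero_add]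
    split_ifs
    · exact le_rfl
    · exact WithTop.coe_le_coe.2 (by norm_num : (-1 : ℤ) ≤ 0)

end BakerAkhiezerOrders

theorem NodalCurve.IsHolomorphicInvolution.mem_singularSet {X : Type*} [TopologicalSpace X]
    [ChartedSpace ℂ X] {Γ : NodalCurve X} {σ : X → X} (hσ : Γ.IsHolomorphicInvolution σ) {x : X}
    (hx : x ∈ Γ.singularSet) : σ x ∈ Γ.singularSet := by
  rcases hx with ⟨e, rfl⟩ | ⟨e, rfl⟩
  all_goals
    obtain ⟨e', he'⟩ := hσ.map_node e
    rcases Sym2.eq_iff.1 he' with h | h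
  · exact Or.inl ⟨e', h.1.symm⟩
  · exact Or.inr ⟨e', h.1.symm⟩
  · exact Or.inr ⟨e', h.2.symm⟩
  · exact Or.inl ⟨e', h.2.symm⟩

end SpectralCurve

/-! ### The sum of the residues of A_i · σ^*A_j · Ω -/

theorem theorem1
    -- the parameters `u` may be real or complex
    {𝕜 : Type*} [RCLike 𝕜] [NormedAlgebra 𝕜 ℂ]
    -- the normalization of the curve: a disjoint union of compact Riemann surfaces
    {X : Type*} [TopologicalSpace X] [T2Space X] [CompactSpace X]
    [ChartedSpace ℂ X] [IsManifold 𝓘(ℂ) ω X]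
    (Γ : SpectralCurve.NodalCurve X)
    -- the divisors: distinct nonsingular points
    {n l r : ℕ} (P Q : Fin n → X) (R : Fin l → X) (γ : Fin r → X)
    (hdistinct : Function.Injective (Sum.elim (Sum.elim P Q) (Sum.elim R γ)))
    (hnonsing : Disjoint (range P ∪ range Q ∪ range R ∪ range γ) Γ.singularSet)
    -- the local parameters `w j = 1 / k_j`
    (w : Fin n → X → ℂ) (hw : ∀ j, SpectralCurve.IsLocalParameter (w j) (P j))
    -- the involution
    (σ : X → X) (hσ : Γ.IsHolomorphicInvolution σ)
    (hσP : ∀ j, σ (P j) = P j) (hσQ : ∀ j, σ (Q j) = Q j)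
    (hσw : ∀ j, ∀ᶠ x in 𝓝 (P j), w j (σ x) = -w j x)
    -- the Baker-Akhiezer section and the gluing conditions
    (U : Set (Fin n → 𝕜)) (hU : IsOpen U) (d : Fin l → ℂ)
    (lam lamσ : Fin Γ.numNodes → ℂ) (hlam : ∀ e, lam e ≠ 0) (hlamσ : ∀ e, lamσ e ≠ 0)
    (ψ : (Fin n → 𝕜) → X → ℂ)
    (hψ : Γ.IsBakerAkhiezerSection P w γ R d lam U ψ)
    (hψσ : ∀ u ∈ U, ∀ e, ψ u (σ (Γ.a e)) = lamσ e * ψ u (σ (Γ.b e)))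
    -- the meromorphic 1-form, not identically zero on any component
    (Ω : SpectralCurve.OneForm X) (hΩ : Ω.IsMeromorphic) (hΩ_ne : ∀ x, Ω.order x ≠ ⊤)
    (hzeros : ∀ x, Ω.zeroMult x =
      (SpectralCurve.divisor P + SpectralCurve.divisor γ + SpectralCurve.divisor (σ ∘ γ)) x)
    (hpoles : ∀ x, (SpectralCurve.divisor Q + SpectralCurve.divisor R +
      SpectralCurve.divisor (σ ∘ R)) x ≤ Ω.poleMult x)
    (hpoles' : ∀ x, Ω.poleMult x ≤ (SpectralCurve.divisor Q + SpectralCurve.divisor R +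
      SpectralCurve.divisor (σ ∘ R) + SpectralCurve.divisor Γ.a + SpectralCurve.divisor Γ.b) x)
    (hres : ∀ e, lam e * lamσ e * Ω.residue (Γ.a e) + Ω.residue (Γ.b e) = 0)
    (hresσ : ∀ e, lam e * lamσ e * Ω.residue (σ (Γ.a e)) + Ω.residue (σ (Γ.b e)) = 0)
    (hresQ : ∀ j, Ω.residue (Q j) = 1) :
    ∀ u ∈ U, ∀ i j : Fin n, i ≠ j →
      ∑ k : Fin n, SpectralCurve.partialDeriv i (fun v => ψ v (Q k)) u *
        SpectralCurve.partialDeriv j (fun v => ψ v (Q k)) u = 0 := by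
  classical
  intro u hu i j hij
  have hPinj : Function.Injective P := fun a b h =>
    Sum.inl.inj (Sum.inl.inj (hdistinct (a₁ := .inl (.inl a)) (a₂ := .inl (.inl b)) h))
  have hQinj : Function.Injective Q := fun a b h =>
    Sum.inr.inj (Sum.inl.inj (hdistinct (a₁ := .inl (.inr a)) (a₂ := .inl (.inr b)) h))
  have hRinj : Function.Injective R := fun a b h =>
    Sum.inl.inj (Sum.inr.inj (hdistinct (a₁ := .inr (.inl a)) (a₂ := .inr (.inl b)) h))
  have hγinj : Function.Injective γ := fun a b h =>
    Sum.inr.inj (Sum.inr.inj (hdistinct (a₁ := .inr (.inr a)) (a₂ := .inr (.inr b)) h))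
  have hPQ : ∀ k k', P k ≠ Q k' := fun k k' h => by
    simpa using hdistinct (a₁ := .inl (.inl k)) (a₂ := .inl (.inr k')) h
  have hQR : ∀ k t, Q k ≠ R t := fun k t h => by
    simpa using hdistinct (a₁ := .inl (.inr k)) (a₂ := .inr (.inl t)) h
  have hQγ : ∀ k s, Q k ≠ γ s := fun k s h => by
    simpa using hdistinct (a₁ := .inl (.inr k)) (a₂ := .inr (.inr s)) h
  have hRγ : ∀ t s, R t ≠ γ s := fun t s h => by
    simpa using hdistinct (a₁ := .inr (.inl t)) (a₂ := .inr (.inr s)) h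
  have hγR : Disjoint (range γ) (range R) := by
    rw [Set.disjoint_left]
    rintro _ ⟨s, rfl⟩ ⟨t, ht⟩
    exact hRγ t s ht
  have hab : ∀ e e', Γ.a e ≠ Γ.b e' := fun e e' h => by
    simpa using Γ.injective (a₁ := .inl e) (a₂ := .inr e') h
  have hainj : Function.Injective Γ.a := fun e e' h =>
    Sum.inl.inj (Γ.injective (a₁ := .inl e) (a₂ := .inl e') h)
  have hbinj : Function.Injective Γ.b := fun e e' h =>
    Sum.inr.inj (Γ.injective (a₁ := .inr e) (a₂ := .inr e') h)
  have hSing : ∀ x ∈ Γ.singularSet,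
      x ∉ range P ∧ x ∉ range Q ∧ x ∉ range R ∧ x ∉ range γ := by
    intro x hx
    have h := Set.disjoint_right.1 hnonsing hx
    simp only [mem_union, not_or] at h
    exact ⟨h.1.1.1, h.1.1.2, h.1.2, h.2⟩
  have haS : ∀ e, Γ.a e ∈ Γ.singularSet := fun e => Or.inl ⟨e, rfl⟩
  have hbS : ∀ e, Γ.b e ∈ Γ.singularSet := fun e => Or.inr ⟨e, rfl⟩
  have hσP' : ∀ x, x ∉ range P → σ x ∉ range P := by
    rintro x hx ⟨k, hk⟩
    exact hx ⟨k, by rw [← hσ.involutive x, ← hk, hσP]⟩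
  have hdσγ := fun x => SpectralCurve.divisor_comp_involution hγinj hσ.involutive x
  have hdσR := fun x => SpectralCurve.divisor_comp_involution hRinj hσ.involutive x
  -- the orders of `Ω`
  obtain ⟨o, ho⟩ : ∃ o : X → ℤ, ∀ x, Ω.order x = o x :=
    ⟨fun x => (Ω.order x).untop₀, fun x => (WithTop.coe_untop₀_of_ne_top (hΩ_ne x)).symm⟩
  have hoz : ∀ x, max (o x) 0 = SpectralCurve.divisor P x + SpectralCurve.divisor γ x +
      SpectralCurve.divisor γ (σ x) := by
    intro x
    have := hzeros x
    rwa [SpectralCurve.OneForm.zeroMult, ho, WithTop.untop₀_coe, Finsupp.add_apply,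
      Finsupp.add_apply, hdσγ] at this
  have hop : ∀ x, max (-o x) 0 ≤ SpectralCurve.divisor Q x + SpectralCurve.divisor R x +
      SpectralCurve.divisor R (σ x) + SpectralCurve.divisor Γ.a x +
      SpectralCurve.divisor Γ.b x := by
    intro x
    have := hpoles' x
    rwa [SpectralCurve.OneForm.poleMult, ho, WithTop.untop₀_coe, Finsupp.add_apply,
      Finsupp.add_apply, Finsupp.add_apply, Finsupp.add_apply, hdσR] at this
  -- Away from R and σR, a pole of Ω can come only from Q or from a double point, and these sets do
  -- not overlap, so it is simple.
  have hΩ_simple : ∀ x, x ∉ range R → σ x ∉ range R → (x ∈ range Q → x ∉ Γ.singularSet) →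
      (-1 : WithTop ℤ) ≤ Ω.order x := by
    intro x hR hσR hQS
    rw [ho]
    refine WithTop.coe_le_coe.2 (?_ : (-1 : ℤ) ≤ o x)
    have h := hop x
    rw [SpectralCurve.divisor_apply_of_notMem hR, SpectralCurve.divisor_apply_of_notMem hσR] at h
    have h1 : SpectralCurve.divisor Q x + SpectralCurve.divisor Γ.a x +
        SpectralCurve.divisor Γ.b x ≤ 1 := by
      by_cases hQ : x ∈ range Q
      · have hS := hQS hQ
        rw [SpectralCurve.divisor_apply_of_mem hQinj hQ,
          SpectralCurve.divisor_apply_of_notMem (fun h => hS (Or.inl h)),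
          SpectralCurve.divisor_apply_of_notMem (fun h => hS (Or.inr h))]
        norm_num
      · rw [SpectralCurve.divisor_apply_of_notMem hQ]
        by_cases ha : x ∈ range Γ.a
        · rw [SpectralCurve.divisor_apply_of_mem hainj ha,
            SpectralCurve.divisor_apply_of_notMem]
          · norm_num
          · rintro ⟨e, rfl⟩
            obtain ⟨e', he'⟩ := ha
            exact hab e' e he'
        · rw [SpectralCurve.divisor_apply_of_notMem ha]
          by_cases hb : x ∈ range Γ.b
          · rw [SpectralCurve.divisor_apply_of_mem hbinj hb]
            norm_num
          · rw [SpectralCurve.divisor_apply_of_notMem hb]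
            norm_num
    omega
  -- the form whose residues are summed
  set A : Fin n → X → ℂ := fun i => SpectralCurve.paramDeriv ψ i u with hA
  set F : X → ℂ := fun x => A i x * A j (σ x) with hF
  set η : SpectralCurve.OneForm X := Ω.mulFun F with hη
  -- All poles of η lie on Q and the double points: at P this is the cancellation of exponentials,
  -- elsewhere a comparison of divisors.
  have hηord : ∀ x, MeromorphicAt (η.coeff x) (chartAt ℂ x x) ∧
      ((-(SpectralCurve.divisor Q x + SpectralCurve.divisor Γ.a x +
        SpectralCurve.divisor Γ.b x) : ℤ) : WithTop ℤ) ≤ η.order x := by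
    intro x
    by_cases hx : x ∈ range P
    · obtain ⟨k, rfl⟩ := hx
      obtain ⟨h1, h2⟩ := hψ.neg_one_le_order_mul_involution hU hu hij k (hw k) hσ (hσP k) (hσw k)
      obtain ⟨h3, h4⟩ := SpectralCurve.OneForm.order_mulFun h1 hΩ
      refine ⟨h3, h4 ▸ ?_⟩
      have h5 := hoz (P k)
      rw [SpectralCurve.divisor_apply_of_mem hPinj ⟨k, rfl⟩] at h5
      have h6 := SpectralCurve.divisor_nonneg γ (P k)
      have h7 := SpectralCurve.divisor_nonneg γ (σ (P k))
      have h8 := SpectralCurve.divisor_nonneg Q (P k)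
      have h9 := SpectralCurve.divisor_nonneg Γ.a (P k)
      have h10 := SpectralCurve.divisor_nonneg Γ.b (P k)
      refine le_trans ?_ (add_le_add_left h2 _)
      rw [ho]
      refine WithTop.coe_le_coe.2 (?_ : _ ≤ (-1 : ℤ) + o (P k))
      omega
    · obtain ⟨h1, h2⟩ := hψ.le_order_paramDeriv hU hγinj hRinj hγR hu i hx
      obtain ⟨h1', h2'⟩ := hψ.le_order_paramDeriv hU hγinj hRinj hγR hu j (hσP' x hx)
      obtain ⟨h3, h4⟩ := SpectralCurve.isMeromorphicAt_and_order_comp_involution hσ.holomorphic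
        hσ.involutive h1'
      obtain ⟨h5, h6⟩ := SpectralCurve.isMeromorphicAt_mul h1 h3
      obtain ⟨h7, h8⟩ := SpectralCurve.OneForm.order_mulFun h5 hΩ
      refine ⟨h7, ?_⟩
      -- From `o = max o 0 - max (-o) 0`, the zeros of Ω absorb γ + σγ and the zeros R + σR absorb
      -- its poles. Counting multiplicities also handles points where γ meets σγ or R meets σR.
      have h9 := hoz x
      have h10 := hop x
      have h11 := SpectralCurve.divisor_nonneg P x
      have h12 : η.order x = SpectralCurve.order (A i) x + SpectralCurve.order (A j) (σ x) +
          Ω.order x := by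
        rw [← h4, ← h6]
        exact h8
      rw [h12, ho]
      refine le_trans ?_ (add_le_add_left (add_le_add h2 h2') _)
      rw [← WithTop.coe_add, ← WithTop.coe_add]
      refine WithTop.coe_le_coe.2 ?_
      omega
  have hFan : ∀ x, x ∉ range P → x ∉ range γ → σ x ∉ range P → σ x ∉ range γ →
      AnalyticAt ℂ (F ∘ (chartAt ℂ x).symm) (chartAt ℂ x x) := fun x h1 h2 h3 h4 =>
    (hψ.analyticAt_paramDeriv hU hu i h1 h2).mul
      (SpectralCurve.analyticAt_comp_involution hσ.holomorphic hσ.involutive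
        (hψ.analyticAt_paramDeriv hU hu j h3 h4))
  have hresS : ∀ x ∈ Γ.singularSet, η.residue x = F x * Ω.residue x := by
    intro x hx
    obtain ⟨h1, h2, h3, h4⟩ := hSing x hx
    obtain ⟨h5, -, h6, h7⟩ := hSing _ (hσ.mem_singularSet hx)
    exact SpectralCurve.OneForm.residue_mulFun (hFan x h1 h4 h5 h7) hΩ
      (hΩ_simple x h3 h6 fun h => absurd h h2)
  have hresQ' : ∀ k, η.residue (Q k) = A i (Q k) * A j (Q k) := by
    intro k
    have h1 : Q k ∉ range P := fun ⟨k', h⟩ => hPQ k' k h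
    have h2 : Q k ∉ range γ := fun ⟨s, h⟩ => hQγ k s h.symm
    have h3 : Q k ∉ range R := fun ⟨t, h⟩ => hQR k t h.symm
    rw [hη, SpectralCurve.OneForm.residue_mulFun, hresQ, mul_one, hF]
    · simp only [hσQ]
    · exact hFan _ h1 h2 (by rwa [hσQ]) (by rwa [hσQ])
    · exact hΩ
    · exact hΩ_simple _ h3 (by rwa [hσQ]) fun _ hS => (hSing _ hS).2.1 ⟨k, rfl⟩
  -- the sum of the residues
  have hinj : Function.Injective (Sum.elim Q (Sum.elim Γ.a Γ.b)) := by
    refine hQinj.sumElim Γ.injective ?_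
    rintro k (e | e) h
    · exact (hSing _ (haS e)).2.1 ⟨k, h⟩
    · exact (hSing _ (hbS e)).2.1 ⟨k, h⟩
  have hres0 : ∀ x ∉ range (Sum.elim Q (Sum.elim Γ.a Γ.b)), η.residue x = 0 := by
    intro x hx
    have hQ : x ∉ range Q := fun ⟨k, hk⟩ => hx ⟨.inl k, hk⟩
    have ha : x ∉ range Γ.a := fun ⟨e, he⟩ => hx ⟨.inr (.inl e), he⟩
    have hb : x ∉ range Γ.b := fun ⟨e, he⟩ => hx ⟨.inr (.inr e), he⟩
    refine SpectralCurve.planeResidue_eq_zero_of_order_nonneg (hηord x).1 ?_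
    have h1 := (hηord x).2
    rw [SpectralCurve.divisor_apply_of_notMem hQ, SpectralCurve.divisor_apply_of_notMem ha,
      SpectralCurve.divisor_apply_of_notMem hb] at h1
    exact h1
  have hnode : ∀ e, η.residue (Γ.a e) + η.residue (Γ.b e) = 0 := by
    intro e
    have hbP := hSing _ (hbS e)
    have hσbP := hSing _ (hσ.mem_singularSet (hbS e))
    have h1 : A i (Γ.a e) = lam e * A i (Γ.b e) :=
      SpectralCurve.NodalCurve.IsBakerAkhiezerSection.paramDeriv_eq_const_mul hU hu i
        (hψ.differentiable u hu _ hbP.1 hbP.2.2.2) (fun v hv => hψ.gluing v hv e)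
    have h2 : A j (σ (Γ.a e)) = lamσ e * A j (σ (Γ.b e)) :=
      SpectralCurve.NodalCurve.IsBakerAkhiezerSection.paramDeriv_eq_const_mul hU hu j
        (hψ.differentiable u hu _ hσbP.1 hσbP.2.2.2) (fun v hv => hψσ v hv e)
    rw [hresS _ (haS e), hresS _ (hbS e)]
    simp only [hF, h1, h2]
    -- The two gluing laws give F(a) = λλ_σ F(b), so the residue condition on Ω appears with the
    -- common factor F(b).
    linear_combination (A i (Γ.b e) * A j (σ (Γ.b e))) * hres e
  have hsum := SpectralCurve.OneForm.IsMeromorphic.sum_residue_eq_zero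
    (η := η) (fun x => (hηord x).1) hinj hres0
  rw [Fintype.sum_sum_type, Fintype.sum_sum_type] at hsum
  simp only [Sum.elim_inl, Sum.elim_inr, hresQ'] at hsum
  rw [← Finset.sum_add_distrib, Finset.sum_eq_zero (s := Finset.univ (α := Fin Γ.numNodes))
    fun e _ => hnode e, add_zero] at hsum
  exact hsum
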